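/- Let $b>0$. Call a function $k:(0,\infty)\to\mathbb R$ *locally integrable completely monotone* (LICM) if it is infinitely differentiable, $(-1)^n k^{(n)}(t)\ge 0$ for all $t>0$ and all integers $n\ge 0$, and $k\in L^1(0,T)$ for every $T>0$. A function $k\in L^1(0,b)$ satisfies the *classical Sonine condition* (CSC) with associated kernel $K\in L^1(0,b)$ if $$\int_0^t K(t-s)\,k(s)\,ds=1\qquad\text{for all } 0<t\le b .$$ Given $w:[0,b]\times[0,b]\to\mathbb R$, a function $k\in L^1(0,b)$ satisfies the *weighted Sonine condition* WSC2 (with weight $w$) with associated kernel $K\in L^1(0,b)$ if there is a function $G(s,t)$, defined for $s,t\ge 0$, $s+t\le b$, such that for all $s\ge 0$, $t>0$ with $s+t\le b$ the following integral converges absolutely and $$\int_0^t w(s,z+s)\,k(t-z)\,K(z)\,dz=G(s,t),$$ and such that (a) there are constants $0<\nu_*\le\nu^*$ with $\nu_*\le|G(s,0)|\le\nu^*$ for $0\le s\le b$; (b) for every $s\in[0,b]$ the function $G(s,\cdot)$ is continuous on $[0,b-s]$ (in particular $G(s,0)=\lim_{t\to0^+}G(s,t)$ for $s<b$), and there is $\bar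 G\in L^1(0,b)$ such that, for all $s\ge0$, $t>0$ with $s+t\le b$, the partial derivative $\partial_tG(s,t)$ exists (one-sided at $t=b-s$) and $|\partial_t G(s,t)|\le\bar G(t)$. **Theorem.** Let $k$ be an LICM function that satisfies the CSC for some associated kernel. Let the weight $w$ satisfy (i) $\mu_*\le|w(t,t)|\le\mu^*$ for all $t\in[0,b]$, for some constants $0<\mu_*\le\mu^*$; (ii') for $0\le s\le t\le b$ the partial derivative $w_2(s,t)=\partial_t w(s,t)$ exists (one-sided at the ends of $[s,b]$), and $|w_2(s,t)|\le Q$ for a constant $Q$ independent of $s$ and $t$. Then $k$ satisfies WSC2 with weight $w$. Moreover, every associated kernel $K$ of $k$ in the CSC is also an associated kernel of $k$ in WSC2 with weight $w$. -/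

import Mathlib

open Set MeasureTheory
open scoped ContDiff

/-- `f` is a locally integrable completely monotone (LICM) function: it is smooth on `(0,∞)`,
`(-1)^n f^(n) ≥ 0` there for all `n ≥ 0`, and it is integrable up to `0`, that is, on every
`(0,T)`. The values of `f` on `(-∞,0]` are irrelevant. -/
def IsLICM (f : ℝ → ℝ) : Prop :=
  ContDiffOn ℝ ∞ f (Ioi 0) ∧
  (∀ n : ℕ, ∀ t : ℝ, 0 < t → 0 ≤ (-1 : ℝ) ^ n * iteratedDeriv n f t) ∧
  ∀ T : ℝ, 0 < T → IntegrableOn f (Ioo 0 T)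

/-- Classical Sonine condition on `(0,b]`: `k, K ∈ L¹(0,b)` and `∫₀ᵗ K(t-s) k(s) ds = 1`.
(The integral is empty for `t = 0`, so the identity is required for `0 < t ≤ b`. As the value `1`
is nonzero, the identity includes the integrability of the integrand.) -/
def IsCSCAssociated (b : ℝ) (k K : ℝ → ℝ) : Prop :=
  IntegrableOn k (Ioo 0 b) ∧ IntegrableOn K (Ioo 0 b) ∧
  ∀ t : ℝ, 0 < t → t ≤ b → ∫ s in (0 : ℝ)..t, K (t - s) * k s = 1

/-- `k` satisfies the classical Sonine condition on `(0,b]`. -/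
def SatisfiesCSC (b : ℝ) (k : ℝ → ℝ) : Prop :=
  ∃ K : ℝ → ℝ, IsCSCAssociated b k K

/-- The weight is nondegenerate on the diagonal: `μ₁ ≤ |w(t,t)| ≤ μ₂` on `[0,b]`, `0 < μ₁ ≤ μ₂`. -/
def WeightNondegenerate (b : ℝ) (w : ℝ → ℝ → ℝ) : Prop :=
  ∃ μ₁ μ₂ : ℝ, 0 < μ₁ ∧ μ₁ ≤ μ₂ ∧
    ∀ t : ℝ, 0 ≤ t → t ≤ b → μ₁ ≤ |w t t| ∧ |w t t| ≤ μ₂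

/-- `|w₂(s,t)| ≤ Q` for `0 ≤ s ≤ t ≤ b`, where `w₂` is the partial derivative in the second
variable, which exists (one-sided at the ends of `[s,b]`). -/
def WeightDerivBounded (b : ℝ) (w : ℝ → ℝ → ℝ) (Q : ℝ) : Prop :=
  ∀ s t : ℝ, 0 ≤ s → s ≤ t → t ≤ b →
    DifferentiableWithinAt ℝ (w s) (Icc s b) t ∧ |derivWithin (w s) (Icc s b) t| ≤ Q

/-- `ν₁ ≤ |g(s,0)| ≤ ν₂` for `0 ≤ s ≤ b` and some `0 < ν₁ ≤ ν₂`. -/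
def KernelNondegenerate (b : ℝ) (g : ℝ → ℝ → ℝ) : Prop :=
  ∃ ν₁ ν₂ : ℝ, 0 < ν₁ ∧ ν₁ ≤ ν₂ ∧
    ∀ s : ℝ, 0 ≤ s → s ≤ b → ν₁ ≤ |g s 0| ∧ |g s 0| ≤ ν₂

/-- For some `γ ∈ L¹(0,b)`, the partial derivative `g₂` exists and `|g₂(s,t)| ≤ γ(t)` whenever
`0 ≤ s`, `0 < t`, `s + t ≤ b` (one-sided derivative at `t = b - s`). Moreover `g(s,·)` is
continuous on `[0,b-s]`, so that `g(s,0)` is the limit of `g(s,t)` as `t → 0⁺` and `g(s,·)` is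
the integral of `g₂(s,·)`. -/
def KernelDerivBounded (b : ℝ) (g : ℝ → ℝ → ℝ) : Prop :=
  (∀ s : ℝ, 0 ≤ s → s ≤ b → ContinuousOn (g s) (Icc 0 (b - s))) ∧
  ∃ γ : ℝ → ℝ, IntegrableOn γ (Ioo 0 b) ∧
    ∀ s t : ℝ, 0 ≤ s → 0 < t → s + t ≤ b →
      DifferentiableWithinAt ℝ (g s) (Icc 0 (b - s)) t ∧
      |derivWithin (g s) (Icc 0 (b - s)) t| ≤ γ t

/-- Second weighted Sonine condition on `(0,b]` with weight `w`: `k, K ∈ L¹(0,b)` and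
`∫₀ᵗ w(s,z+s) k(t-z) K(z) dz = G(s,t)` (the integral converging absolutely) for `0 ≤ s`, `0 < t`,
`s + t ≤ b`, where `G` satisfies the two preceding conditions. -/
def IsWSC2Associated (b : ℝ) (w : ℝ → ℝ → ℝ) (k K : ℝ → ℝ) : Prop :=
  IntegrableOn k (Ioo 0 b) ∧ IntegrableOn K (Ioo 0 b) ∧
  ∃ G : ℝ → ℝ → ℝ,
    (∀ s t : ℝ, 0 ≤ s → 0 < t → s + t ≤ b →
      IntervalIntegrable (fun z => w s (z + s) * k (t - z) * K z) volume 0 t ∧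
      ∫ z in (0 : ℝ)..t, w s (z + s) * k (t - z) * K z = G s t) ∧
    KernelNondegenerate b G ∧ KernelDerivBounded b G

/-- `k` satisfies the second weighted Sonine condition on `(0,b]` with weight `w`. -/
def SatisfiesWSC2 (b : ℝ) (w : ℝ → ℝ → ℝ) (k : ℝ → ℝ) : Prop :=
  ∃ K : ℝ → ℝ, IsWSC2Associated b w k K

/-! Fix `s` and put `v(z) = w(s,z+s)`, so that `G(s,t) = ∫₀ᵗ v(z) k(t-z) K(z) dz`. Two facts about a
Sonine partner carry the proof: `K ≥ 0`, and `K(t) ≤ C/t` almost everywhere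
(`IsLICM.partner_ae_mem`).

They come from a discretization. Complete monotonicity makes the cell integrals of `k` log-convex,
so by Kaluza's lemma the discrete Sonine equation has a nonnegative nonincreasing solution, which
defines a step function `e_h`. Since `k` blows up at `0`, `k * e_h → 1` boundedly as `h → 0`, and
from `1 * e_h = K * (k * e_h)` the primitives of `e_h` converge to that of `K`. That primitive is
therefore nondecreasing, with the growth bound of a concave function.

Now `k(t-z) K(z) dz` is a probability measure on `(0,t)`, whence `|G(s,t) - w(s,s)| ≤ Qt`. For the
derivative at `t`, subtract the constant `v(t)`: the factor `v(z) - v(t)` vanishes to first order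
where `k'(t-z)` is singular, and `x|k'(x)| ≤ 2k(x/2)`. So `∂ₜG` is bounded by `2Q` times the
convolution of `k(x/2)` with `|K|`, which is integrable and independent of `s`. -/

/-! ### Completely monotone functions: log-convexity and derivative bounds -/

/-- Complete monotonicity on `(0,∞)`, without any integrability. -/
def IsCompletelyMonotone (f : ℝ → ℝ) : Prop :=
  ContDiffOn ℝ ∞ f (Ioi 0) ∧
    ∀ n : ℕ, ∀ t : ℝ, 0 < t → 0 ≤ (-1 : ℝ) ^ n * iteratedDeriv n f t

theorem IsLICM.isCompletelyMonotone {f : ℝ → ℝ} (hf : IsLICM f) : IsCompletelyMonotone f :=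
  ⟨hf.1, hf.2.1⟩

namespace IsCompletelyMonotone

variable {f : ℝ → ℝ}

theorem contDiffAt (hf : IsCompletelyMonotone f) {t : ℝ} (ht : 0 < t) : ContDiffAt ℝ ∞ f t :=
  hf.1.contDiffAt (Ioi_mem_nhds ht)

theorem hasDerivAt_iteratedDeriv (hf : IsCompletelyMonotone f) (n : ℕ) {t : ℝ} (ht : 0 < t) :
    HasDerivAt (iteratedDeriv n f) (iteratedDeriv (n + 1) f t) t := by
  rw [iteratedDeriv_succ]
  have h : ContDiffOn ℝ ((n + 1 : ℕ) : WithTop ℕ∞) f (Ioi 0) :=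
    hf.1.of_le (by exact_mod_cast le_top)
  have hd := (h.differentiableOn_iteratedDerivWithin (m := n)
    (by exact_mod_cast Nat.lt_succ_self n) (uniqueDiffOn_Ioi 0)).differentiableAt (Ioi_mem_nhds ht)
  refine (hd.congr_of_eventuallyEq ?_).hasDerivAt
  filter_upwards [Ioi_mem_nhds ht] with x hx
  exact (iteratedDerivWithin_of_isOpen isOpen_Ioi hx).symm

theorem antitoneOn_iteratedDeriv (hf : IsCompletelyMonotone f) (n : ℕ) :
    AntitoneOn (fun t => (-1 : ℝ) ^ n * iteratedDeriv n f t) (Ioi 0) := by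
  have hd : ∀ t ∈ Ioi (0 : ℝ), HasDerivAt (fun t => (-1 : ℝ) ^ n * iteratedDeriv n f t)
      ((-1 : ℝ) ^ n * iteratedDeriv (n + 1) f t) t := fun t ht =>
    (hf.hasDerivAt_iteratedDeriv n ht).const_mul _
  apply antitoneOn_of_deriv_nonpos (convex_Ioi 0)
  · exact fun t ht => (hd t ht).continuousAt.continuousWithinAt
  · rw [interior_Ioi]
    exact fun t ht => (hd t ht).differentiableAt.differentiableWithinAt
  · rw [interior_Ioi]
    intro t ht
    rw [(hd t ht).deriv]
    have := hf.2 (n + 1) t ht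
    rw [pow_succ] at this
    linarith

theorem nonneg (hf : IsCompletelyMonotone f) {t : ℝ} (ht : 0 < t) : 0 ≤ f t := by
  simpa using hf.2 0 t ht

theorem antitoneOn (hf : IsCompletelyMonotone f) : AntitoneOn f (Ioi 0) := by
  simpa using hf.antitoneOn_iteratedDeriv 0

theorem hasDerivAt (hf : IsCompletelyMonotone f) {t : ℝ} (ht : 0 < t) :
    HasDerivAt f (deriv f t) t := by
  simpa using hf.hasDerivAt_iteratedDeriv 0 ht

theorem deriv_nonpos (hf : IsCompletelyMonotone f) {t : ℝ} (ht : 0 < t) : deriv f t ≤ 0 := by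
  simpa using hf.2 1 t ht

theorem monotoneOn_deriv (hf : IsCompletelyMonotone f) : MonotoneOn (deriv f) (Ioi 0) := by
  have := (hf.antitoneOn_iteratedDeriv 1).neg
  simpa [Pi.neg_def] using this

theorem comp_add_const (hf : IsCompletelyMonotone f) {δ : ℝ} (hδ : 0 ≤ δ) :
    IsCompletelyMonotone (fun x => f (x + δ)) := by
  refine ⟨hf.1.comp (contDiff_id.add contDiff_const).contDiffOn
    fun x (hx : 0 < x) => add_pos_of_pos_of_nonneg hx hδ, fun n t ht => ?_⟩
  rw [iteratedDeriv_comp_add_const]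
  exact hf.2 n _ (by linarith)

theorem sub_comp_add_const (hf : IsCompletelyMonotone f) {δ : ℝ} (hδ : 0 ≤ δ) :
    IsCompletelyMonotone (fun x => f x - f (x + δ)) := by
  have hs := hf.comp_add_const hδ
  refine ⟨hf.1.sub hs.1, fun n t ht => ?_⟩
  have hn : ((n : ℕ∞) : WithTop ℕ∞) ≤ ∞ := by exact_mod_cast le_top
  have h := iteratedDeriv_fun_sub ((hf.contDiffAt ht).of_le hn) ((hs.contDiffAt ht).of_le hn)
  rw [h, iteratedDeriv_comp_add_const]
  have := hf.antitoneOn_iteratedDeriv n (show (0 : ℝ) < t from ht)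
    (show (0 : ℝ) < t + δ by linarith) (by linarith)
  simp only at this
  linarith

/-- The shift `f ↦ f (· + δ)` as a linear operator. -/
noncomputable def shift (δ : ℝ) : Module.End ℝ (ℝ → ℝ) := LinearMap.funLeft ℝ ℝ (· + δ)

theorem shift_apply (δ : ℝ) (f : ℝ → ℝ) : shift δ f = fun x => f (x + δ) := rfl

/-- Consequently every Bernstein basis polynomial, evaluated at the shift operator, sends `f` to a
function that is nonnegative on `(0,∞)`. This replaces an integral representation of `f`. -/
theorem shift_pow_mul_pow (hf : IsCompletelyMonotone f) {δ : ℝ} (hδ : 0 ≤ δ) (i j : ℕ) :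
    IsCompletelyMonotone ((shift δ ^ i * (1 - shift δ) ^ j) f) := by
  induction i with
  | zero =>
    induction j with
    | zero => simpa using hf
    | succ j ih =>
      rw [pow_zero, one_mul] at ih ⊢
      rw [pow_succ', Module.End.mul_apply]
      exact ih.sub_comp_add_const hδ
  | succ i ih =>
    rw [pow_succ', mul_assoc, Module.End.mul_apply]
    exact ih.comp_add_const hδ

-- Expand `nl - ν = n(l - X) + (nX - ν)` and use the mean and variance of the binomial distribution.
-- After division by `n²` this exhibits `(l - X)²` as a limit of polynomials with nonnegative
-- Bernstein coefficients.
open Polynomial in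
theorem bernstein_sum_sq (n : ℕ) (l : ℝ) :
    ∑ ν ∈ Finset.range (n + 1), C (((n : ℝ) * l - ν) ^ 2) * bernsteinPolynomial ℝ n ν =
      (n : ℝ[X]) * X * (1 - X) + (n : ℝ[X]) ^ 2 * (C l - X) ^ 2 := by
  have h0 := bernsteinPolynomial.sum ℝ n
  have h1 := bernsteinPolynomial.sum_smul ℝ n
  have h2 := bernsteinPolynomial.variance ℝ n
  simp only [nsmul_eq_mul] at h1 h2
  have key : ∀ ν ∈ Finset.range (n + 1), C (((n : ℝ) * l - ν) ^ 2) * bernsteinPolynomial ℝ n ν =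
      ((n : ℝ[X]) * X - (ν : ℝ[X])) ^ 2 * bernsteinPolynomial ℝ n ν
      + ((n : ℝ[X]) ^ 2 * (C l - X) ^ 2 + 2 * (n : ℝ[X]) * (C l - X) * ((n : ℝ[X]) * X)) * bernsteinPolynomial ℝ n ν
      - (2 * (n : ℝ[X]) * (C l - X)) * ((ν : ℝ[X]) * bernsteinPolynomial ℝ n ν) := by
    intro ν _
    simp only [map_pow, map_sub, map_mul, map_natCast]
    ring
  rw [Finset.sum_congr rfl key, Finset.sum_sub_distrib, Finset.sum_add_distrib, ← Finset.mul_sum,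
    ← Finset.mul_sum, h0, h1, h2]
  ring

open Polynomial in
/-- Log-convexity, in the form of a nonnegative quadratic polynomial. -/
theorem quadratic_nonneg (hf : IsCompletelyMonotone f) {x δ : ℝ} (hx : 0 < x) (hδ : 0 ≤ δ)
    (l : ℝ) : 0 ≤ l ^ 2 * f x - 2 * l * f (x + δ) + f (x + 2 * δ) := by
  -- The Bernstein identity with `X` replaced by the shift, applied to `f` at `x`. Nonnegativity for
  -- every `n` forces the coefficient of `n²` to be nonnegative.
  have hn : ∀ n : ℕ, 0 ≤ n * (f (x + δ) - f (x + 2 * δ)) +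
      n ^ 2 * (l ^ 2 * f x - 2 * l * f (x + δ) + f (x + 2 * δ)) := by
    intro n
    have h := congrArg (fun p : ℝ[X] => aeval (shift δ) p f x) (bernstein_sum_sq n l)
    have e1 : aeval (shift δ) ((n : ℝ[X]) * X * (1 - X) + (n : ℝ[X]) ^ 2 * (C l - X) ^ 2) f x =
        n * (f (x + δ) - f (x + 2 * δ)) +
          n ^ 2 * (l ^ 2 * f x - 2 * l * f (x + δ) + f (x + 2 * δ)) := by
      have e : (n : ℝ[X]) * X * (1 - X) + (n : ℝ[X]) ^ 2 * (C l - X) ^ 2 =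
        C (n : ℝ) * (X - X ^ 2) + C ((n : ℝ) ^ 2) * (C (l ^ 2) - C (2 * l) * X + X ^ 2) := by
        simp only [map_pow, map_mul, map_natCast, map_ofNat]
        ring
      rw [e]
      simp only [map_add, map_mul, map_sub, aeval_C, aeval_X,
        Algebra.algebraMap_eq_smul_one, smul_mul_assoc, one_mul, LinearMap.add_apply,
        LinearMap.smul_apply, LinearMap.sub_apply, Pi.add_apply, Pi.sub_apply, Pi.smul_apply,
        Module.End.one_apply, pow_two, Module.End.mul_apply, shift_apply, smul_eq_mul]
      rw [show x + δ + δ = x + 2 * δ by ring]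
      ring
    rw [e1] at h
    rw [← h, map_sum, LinearMap.sum_apply, Finset.sum_apply]
    refine Finset.sum_nonneg fun ν _ => ?_
    have e2 : aeval (shift δ) (C (((n : ℝ) * l - ν) ^ 2) * bernsteinPolynomial ℝ n ν) f x =
        ((n : ℝ) * l - ν) ^ 2 * ((n.choose ν : ℝ) *
          (shift δ ^ ν * (1 - shift δ) ^ (n - ν)) f x) := by
      rw [bernsteinPolynomial, ← map_natCast (C : ℝ →+* ℝ[X]), mul_assoc (C _) (X ^ _)]
      simp only [map_mul, aeval_C, Algebra.algebraMap_eq_smul_one, smul_mul_assoc, one_mul,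
        LinearMap.smul_apply, Pi.smul_apply, smul_eq_mul, map_pow (aeval (shift δ)), aeval_X,
        map_sub, map_one]
    rw [e2]
    have := (hf.shift_pow_mul_pow hδ ν (n - ν)).nonneg hx
    positivity
  set q := l ^ 2 * f x - 2 * l * f (x + δ) + f (x + 2 * δ) with hq
  set d := f (x + δ) - f (x + 2 * δ)
  by_contra! hneg
  obtain ⟨n, hn'⟩ := exists_nat_gt (|d| / (-q))
  have hn0 : (0 : ℝ) < n := lt_of_le_of_lt (by positivity [neg_pos.2 hneg]) hn'
  rw [div_lt_iff₀ (neg_pos.2 hneg)] at hn'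
  have h := hn n
  have h3 : 0 ≤ (n : ℝ) * (d + n * q) := by linarith [h, show (n : ℝ) * (d + n * q) = n * d + n ^ 2 * q by ring]
  have h4 : 0 ≤ d + n * q := nonneg_of_mul_nonneg_right h3 hn0
  linarith [le_abs_self d]

/-- A completely monotone function vanishing somewhere vanishes identically. -/
theorem pos_of_ne_zero (hf : IsCompletelyMonotone f) {x₀ : ℝ} (hx₀ : 0 < x₀) (h₀ : f x₀ ≠ 0)
    {x : ℝ} (hx : 0 < x) : 0 < f x := by
  have step : ∀ c : ℝ, 0 < c → f c = 0 → f (2 / 3 * c) = 0 := by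
    intro c hc h
    have hz : f (1 / 3 * c + 2 * (1 / 3 * c)) = 0 := by
      rw [← h]; congr 1; ring
    have hq := fun l => hf.quadratic_nonneg (x := 1 / 3 * c) (δ := 1 / 3 * c) (by positivity)
      (by positivity) l
    rw [hz] at hq
    rw [show 1 / 3 * c + 1 / 3 * c = 2 / 3 * c by ring] at hq
    have hp := hf.nonneg (show 0 < 2 / 3 * c by positivity)
    have hp' := hf.nonneg (show 0 < 1 / 3 * c by positivity)
    by_contra hne
    have hpos : 0 < f (2 / 3 * c) := lt_of_le_of_ne hp (Ne.symm hne)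
    -- With `f c = 0` the form is `l²A - 2lB`, negative for small `l > 0` unless `B = 0`. The `+ 1`
    -- keeps the denominator positive when `A = 0`.
    have := hq (f (2 / 3 * c) / (f (1 / 3 * c) + 1))
    set A := f (1 / 3 * c)
    set B := f (2 / 3 * c)
    have e : (B / (A + 1)) ^ 2 * A - 2 * (B / (A + 1)) * B + 0 =
        -(B ^ 2 * (A + 2) / (A + 1) ^ 2) := by
      field_simp
      ring
    rw [e] at this
    have : 0 < B ^ 2 * (A + 2) / (A + 1) ^ 2 := by positivity
    linarith
  refine lt_of_le_of_ne (hf.nonneg hx) fun h => h₀ ?_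
  -- The zeros accumulate at `0`, and monotonicity carries them to the right up to `x₀`.
  have hz : ∀ n : ℕ, f ((2 / 3) ^ n * x) = 0 := by
    intro n
    induction n with
    | zero => simpa using h.symm
    | succ n ih => rw [pow_succ', mul_assoc]; exact step _ (by positivity) ih
  obtain ⟨n, hn⟩ := exists_pow_lt_of_lt_one (show 0 < x₀ / x by positivity)
    (show (2 / 3 : ℝ) < 1 by norm_num)
  rw [lt_div_iff₀ hx] at hn
  refine le_antisymm ?_ (hf.nonneg hx₀)
  rw [← hz n]
  exact hf.antitoneOn (show 0 < (2 / 3 : ℝ) ^ n * x by positivity) hx₀ hn.le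

theorem sub_le_neg_deriv_mul (hf : IsCompletelyMonotone f) {x y : ℝ} (hx : 0 < x) (hxy : x ≤ y) :
    f x - f y ≤ -deriv f x * (y - x) := by
  rcases hxy.eq_or_lt with rfl | hlt
  · simp
  obtain ⟨c, hc, h⟩ := exists_deriv_eq_slope f hlt
    (fun z hz => (hf.hasDerivAt (hx.trans_le hz.1)).continuousAt.continuousWithinAt)
    (fun z hz => (hf.hasDerivAt (hx.trans hz.1)).differentiableAt.differentiableWithinAt)
  have hm := hf.monotoneOn_deriv (show 0 < x from hx) (show 0 < c from hx.trans hc.1) hc.1.le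
  rw [h, le_div_iff₀ (by linarith)] at hm
  linarith

theorem neg_deriv_mul_le_sub (hf : IsCompletelyMonotone f) {x y : ℝ} (hx : 0 < x) (hxy : x ≤ y) :
    -deriv f y * (y - x) ≤ f x - f y := by
  rcases hxy.eq_or_lt with rfl | hlt
  · simp
  obtain ⟨c, hc, h⟩ := exists_deriv_eq_slope f hlt
    (fun z hz => (hf.hasDerivAt (hx.trans_le hz.1)).continuousAt.continuousWithinAt)
    (fun z hz => (hf.hasDerivAt (hx.trans hz.1)).differentiableAt.differentiableWithinAt)
  have hm := hf.monotoneOn_deriv (show 0 < c from hx.trans hc.1) (show 0 < y by exact hx.trans hlt)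
    hc.2.le
  rw [h, div_le_iff₀ (by linarith)] at hm
  linarith

/-- Convexity on `[x/2, x]`. The bound trades the singularity of `f'` at `0` for that of `f`, which
is integrable in the LICM case. -/
theorem mul_abs_deriv_le (hf : IsCompletelyMonotone f) {x : ℝ} (hx : 0 < x) :
    x * |deriv f x| ≤ 2 * f (x / 2) := by
  rw [abs_of_nonpos (hf.deriv_nonpos hx)]
  have := hf.neg_deriv_mul_le_sub (show 0 < x / 2 by positivity) (by linarith : x / 2 ≤ x)
  have := hf.nonneg hx
  linarith

end IsCompletelyMonotone

/-! ### The discrete Sonine equation and Kaluza's lemma -/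

/-- The sequence `c` determined by `∑ j ≤ n, a (n - j) * c j = 1` for all `n`. -/
noncomputable def sonineSeq (a : ℕ → ℝ) : ℕ → ℝ
  | n => (1 - ∑ j : Fin n, a (n - j) * sonineSeq a j) / a 0

theorem sum_mul_sonineSeq {a : ℕ → ℝ} (h0 : a 0 ≠ 0) (n : ℕ) :
    ∑ j ∈ Finset.range (n + 1), a (n - j) * sonineSeq a j = 1 := by
  rw [Finset.sum_range_succ, Nat.sub_self]
  conv_lhs => rw [sonineSeq.eq_1 a n]
  rw [Finset.sum_range fun j => a (n - j) * sonineSeq a j]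
  field_simp
  ring

theorem sonineSeq_zero (a : ℕ → ℝ) : sonineSeq a 0 = 1 / a 0 := by
  rw [sonineSeq]
  simp

/-- Kaluza's lemma: for log-convex `a`, the sequence `sonineSeq a` is nonincreasing. -/
theorem sonineSeq_antitone {a : ℕ → ℝ} (hpos : ∀ n, 0 < a n)
    (hlc : ∀ n, a (n + 1) ^ 2 ≤ a n * a (n + 2)) : Antitone (sonineSeq a) := by
  set c := sonineSeq a
  set d : ℕ → ℝ := fun m => c m - c (m + 1)
  -- The ratios `a (i + 1) / a i` are nondecreasing, in cross-multiplied form.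
  have hrat : ∀ i n, i ≤ n → a (i + 1) * a n ≤ a (n + 1) * a i := by
    intro i n hin
    induction n, hin using Nat.le_induction with
    | base => exact le_rfl
    | succ n _ ih =>
      have h1 := hlc n
      have h2 : a (i + 1) * a (n + 1) * a n ≤ a (n + 2) * a i * a n := by
        calc a (i + 1) * a (n + 1) * a n = (a (i + 1) * a n) * a (n + 1) := by ring
          _ ≤ (a (n + 1) * a i) * a (n + 1) := mul_le_mul_of_nonneg_right ih (hpos _).le
          _ = a (n + 1) ^ 2 * a i := by ring
          _ ≤ (a n * a (n + 2)) * a i := mul_le_mul_of_nonneg_right h1 (hpos _).le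
          _ = _ := by ring
      exact le_of_mul_le_mul_right h2 (hpos n)
  -- Subtracting consecutive Sonine equations gives a renewal equation for the decrements `d`.
  have hconv : ∀ n, a (n + 1) * c 0 = ∑ m ∈ Finset.range (n + 1), a (n - m) * d m := by
    intro n
    have e1 := sum_mul_sonineSeq (hpos 0).ne' n
    have e2 := sum_mul_sonineSeq (hpos 0).ne' (n + 1)
    rw [Finset.sum_range_succ'] at e2
    simp only [Nat.add_sub_add_right, Nat.sub_zero] at e2
    simp only [d, mul_sub, Finset.sum_sub_distrib]
    linarith
  have hd : ∀ m, 0 ≤ d m := by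
    intro m
    induction m using Nat.strong_induction_on with
    | _ m ih =>
      -- For `m ≥ 1`, compare with the renewal equation one index lower: by `hrat`, passing from `a
      -- (m - 1 - i)` to `a (m - i)` multiplies each term by at most `a (m + 1) / a m`.
      have key : ∑ i ∈ Finset.range m, a (m - i) * d i ≤ a (m + 1) * c 0 := by
        rcases m with _ | m
        · have : 0 < c 0 := by
            simp only [c, sonineSeq_zero]; exact one_div_pos.2 (hpos 0)
          simpa using (mul_pos (hpos 1) this).le
        · have h1 : a (m + 1) * ∑ i ∈ Finset.range (m + 1), a (m + 1 - i) * d i ≤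
              a (m + 2) * ∑ i ∈ Finset.range (m + 1), a (m - i) * d i := by
            rw [Finset.mul_sum, Finset.mul_sum]
            refine Finset.sum_le_sum fun i hi => ?_
            have him : i ≤ m := Nat.lt_succ_iff.1 (Finset.mem_range.1 hi)
            have h := hrat (m - i) (m + 1) (by omega)
            rw [show m - i + 1 = m + 1 - i by omega] at h
            have := mul_le_mul_of_nonneg_right h (ih i (by omega))
            calc _ = a (m + 1 - i) * a (m + 1) * d i := by ring
              _ ≤ _ := this
              _ = _ := by ring
          rw [← hconv] at h1
          have h2 : a (m + 1) * ∑ i ∈ Finset.range (m + 1), a (m + 1 - i) * d i ≤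
              a (m + 1) * (a (m + 2) * c 0) := by linarith
          exact le_of_mul_le_mul_left h2 (hpos _)
      rw [hconv, Finset.sum_range_succ, Nat.sub_self] at key
      have h3 : 0 ≤ a 0 * d m := by linarith
      exact nonneg_of_mul_nonneg_right h3 (hpos 0)
  exact antitone_nat_of_succ_le fun n => sub_nonneg.1 (hd n)

/-- If the earlier terms are nonnegative, raising the index of the decreasing `a` lowers their
convolution sum below `1`, and the new term makes up the deficit. -/
theorem sonineSeq_nonneg {a : ℕ → ℝ} (hpos : ∀ n, 0 < a n) (hanti : Antitone a) (n : ℕ) :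
    0 ≤ sonineSeq a n := by
  induction n using Nat.strong_induction_on with
  | _ n ih =>
    rcases n with _ | n
    · rw [sonineSeq_zero]; exact (one_div_pos.2 (hpos 0)).le
    have e1 := sum_mul_sonineSeq (hpos 0).ne' n
    have e2 := sum_mul_sonineSeq (hpos 0).ne' (n + 1)
    rw [Finset.sum_range_succ, Nat.sub_self] at e2
    have h : ∑ j ∈ Finset.range (n + 1), a (n + 1 - j) * sonineSeq a j ≤
        ∑ j ∈ Finset.range (n + 1), a (n - j) * sonineSeq a j :=
      Finset.sum_le_sum fun j hj => mul_le_mul_of_nonneg_right (hanti (by omega))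
        (ih j (Finset.mem_range.1 hj))
    exact nonneg_of_mul_nonneg_right (by linarith) (hpos 0)

/-! ### Convolution on the half-line -/

open scoped Convolution in
theorem convolution_eq_intervalIntegral {f g : ℝ → ℝ} (hf : ∀ x ≤ 0, f x = 0)
    (hg : ∀ x ≤ 0, g x = 0) {x : ℝ} (hx : 0 ≤ x) :
    (f ⋆[ContinuousLinearMap.mul ℝ ℝ, volume] g) x = ∫ t in (0 : ℝ)..x, f t * g (x - t) := by
  rw [intervalIntegral.integral_of_le hx,
    setIntegral_eq_integral_of_forall_compl_eq_zero (fun t ht => ?_)]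
  · rfl
  · rcases le_or_gt t 0 with h | h
    · simp [hf t h]
    · rw [hg (x - t) (by by_contra! h'; exact ht ⟨h, by linarith⟩), mul_zero]

-- A bounded third factor makes the outer integrals converge at every point, so associativity holds
-- at every `x`, not just almost everywhere.
open scoped Convolution in
theorem convolution_assoc_of_bounded {f g e : ℝ → ℝ} (hf : Integrable f) (hg : Integrable g)
    (he : Measurable e) {M : ℝ} (hM : ∀ x, |e x| ≤ M) (x : ℝ) :
    ((f ⋆[ContinuousLinearMap.mul ℝ ℝ, volume] g) ⋆[ContinuousLinearMap.mul ℝ ℝ, volume] e) x =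
      (f ⋆[ContinuousLinearMap.mul ℝ ℝ, volume]
        (g ⋆[ContinuousLinearMap.mul ℝ ℝ, volume] e)) x := by
  have hbd : ∀ y, Integrable (fun t => ‖g t‖ * ‖e (y - t)‖) := fun y =>
    hg.norm.mul_bdd (c := M) ((he.comp (measurable_const.sub measurable_id)).norm.aestronglyMeasurable)
      (ae_of_all _ fun t => by simpa using hM (y - t))
  refine convolution_assoc _ _ _ _ (fun a b c => by simp [mul_assoc]) hf.1 hg.1
    he.aestronglyMeasurable ?_ (ae_of_all _ hbd) ?_
  · exact hf.ae_convolution_exists _ hg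
  · have hm : AEStronglyMeasurable
        ((fun x => ‖g x‖) ⋆[ContinuousLinearMap.mul ℝ ℝ, volume] fun x => ‖e x‖) volume := by
      exact (AEStronglyMeasurable.convolution_integrand (ContinuousLinearMap.mul ℝ ℝ) hg.norm.1
        he.norm.aestronglyMeasurable).integral_prod_right'
    refine hf.norm.mul_bdd (c := ∫ t, ‖g t‖ * M) ?_ (ae_of_all _ fun t => ?_)
    · exact hm.comp_quasiMeasurePreserving
        (quasiMeasurePreserving_sub_left_of_right_invariant volume x)
    · change ‖∫ s, ‖g s‖ * ‖e (x - t - s)‖‖ ≤ _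
      rw [Real.norm_of_nonneg (integral_nonneg fun s =>
        mul_nonneg (norm_nonneg (g s)) (norm_nonneg (e (x - t - s))))]
      refine integral_mono (hbd _) (hg.norm.mul_const M) fun s => ?_
      exact mul_le_mul_of_nonneg_left (hM _) (norm_nonneg _)

/-! ### Blow-up and positivity of `k` -/

namespace IsLICM

variable {k : ℝ → ℝ}

theorem intervalIntegrable (hk : IsLICM k) {x y : ℝ} (hx : 0 ≤ x) (hy : 0 ≤ y) :
    IntervalIntegrable k volume x y := by
  have h : IntervalIntegrable k volume 0 (max x y + 1) := by
    rw [intervalIntegrable_iff_integrableOn_Ioo_of_le (by positivity)]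
    exact hk.2.2 _ (by positivity)
  refine h.mono_set ?_
  rw [uIcc_of_le (by positivity : (0 : ℝ) ≤ max x y + 1)]
  refine uIcc_subset_Icc ⟨hx, ?_⟩ ⟨hy, ?_⟩
  · linarith [le_max_left x y]
  · linarith [le_max_right x y]

/-- `k` is unbounded near `0` if it has a Sonine partner. -/
theorem tendsto_atTop (hk : IsLICM k) {b : ℝ} (hb : 0 < b) {K : ℝ → ℝ}
    (hK : IsCSCAssociated b k K) : Filter.Tendsto k (nhdsWithin 0 (Ioi 0)) Filter.atTop := by
  have hcm := hk.isCompletelyMonotone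
  obtain ⟨-, hKi, hconv⟩ := hK
  have hKint : IntervalIntegrable K volume 0 b := by
    rwa [intervalIntegrable_iff_integrableOn_Ioo_of_le hb.le]
  -- If `k ≤ M`, the Sonine integral is at most `M ∫₀ᵗ |K|`, which tends to `0` with `t` and cannot
  -- stay equal to `1`. If `k` is unbounded, monotonicity gives the limit.
  by_cases hub : ∃ M : ℝ, ∀ x, 0 < x → k x ≤ M
  · exfalso
    obtain ⟨M, hM⟩ := hub
    have hM0 : 0 ≤ M := (hcm.nonneg one_pos).trans (hM 1 one_pos)
    have hle : ∀ t ∈ Ioc 0 b, 1 ≤ M * ∫ s in (0 : ℝ)..t, |K s| := by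
      intro t ht
      have hKt : IntervalIntegrable K volume 0 t :=
        hKint.mono_set (by rw [uIcc_of_le ht.1.le, uIcc_of_le hb.le]; exact Icc_subset_Icc_right ht.2)
      have h1 : IntervalIntegrable (fun s => |K (t - s)| * M) volume 0 t := by
        have := (hKt.abs.comp_sub_left t).symm.mul_const M
        simpa using this
      calc (1 : ℝ) = ‖∫ s in (0 : ℝ)..t, K (t - s) * k s‖ := by rw [hconv t ht.1 ht.2]; simp
        _ ≤ ∫ s in (0 : ℝ)..t, |K (t - s)| * M := by
          refine intervalIntegral.norm_integral_le_of_norm_le ht.1.le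
            (ae_of_all _ fun s hs => ?_) h1
          rw [norm_mul, Real.norm_eq_abs, Real.norm_of_nonneg (hcm.nonneg hs.1)]
          exact mul_le_mul_of_nonneg_left (hM s hs.1) (abs_nonneg _)
        _ = M * ∫ s in (0 : ℝ)..t, |K s| := by
          rw [intervalIntegral.integral_mul_const,
            intervalIntegral.integral_comp_sub_left (fun s => |K s|) t]
          simp [mul_comm]
    have hc : ContinuousOn (fun t => M * ∫ s in (0 : ℝ)..t, |K s|) (uIcc 0 b) :=
      continuousOn_const.mul (intervalIntegral.continuousOn_primitive_interval
        (by rw [uIcc_of_le hb.le]; exact ((integrableOn_Icc_iff_integrableOn_Ioo (μ := volume)).2 hKi).abs))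
    have h0 := (hc 0 left_mem_uIcc).mono (show Ioc 0 b ⊆ uIcc 0 b by
      rw [uIcc_of_le hb.le]; exact Ioc_subset_Icc_self)
    have hne : (nhdsWithin (0 : ℝ) (Ioc 0 b)).NeBot := by
      rw [nhdsWithin_Ioc_eq_nhdsGT hb]; infer_instance
    have := ge_of_tendsto h0 (Filter.eventually_of_mem self_mem_nhdsWithin hle)
    simp at this
    linarith
  · push Not at hub
    rw [Filter.tendsto_atTop]
    intro M
    obtain ⟨x, hx, hMx⟩ := hub M
    filter_upwards [Ioo_mem_nhdsGT hx] with y hy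
    exact hMx.le.trans (hcm.antitoneOn hy.1 hx hy.2.le)

theorem pos (hk : IsLICM k) {b : ℝ} (hb : 0 < b) {K : ℝ → ℝ}
    (hK : IsCSCAssociated b k K) {x : ℝ} (hx : 0 < x) : 0 < k x := by
  obtain ⟨y, hy, hy0⟩ := (((hk.tendsto_atTop hb hK).eventually_gt_atTop 0).and
    self_mem_nhdsWithin).exists
  exact hk.isCompletelyMonotone.pos_of_ne_zero hy0 hy.ne' hx

end IsLICM

/-! ### Approximate partners on a grid -/

/-- The integral of `k` over the `n`-th cell of the grid of width `h`. -/
noncomputable def cellIntegral (k : ℝ → ℝ) (h : ℝ) (n : ℕ) : ℝ :=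
  ∫ x in (n * h)..((n + 1 : ℕ) * h), k x

/-- The step function on `(0,∞)` whose convolution with `k` equals `1` on the grid of width `h`. -/
noncomputable def stepPartner (k : ℝ → ℝ) (h t : ℝ) : ℝ :=
  if 0 < t then sonineSeq (cellIntegral k h) ⌊t / h⌋₊ else 0

namespace IsLICM

variable {k : ℝ → ℝ} {h : ℝ}

theorem cellIntegral_eq (h : ℝ) (n : ℕ) :
    cellIntegral k h n = ∫ x in (0 : ℝ)..h, k (x + n * h) := by
  rw [intervalIntegral.integral_comp_add_right, cellIntegral]
  congr 1
  · ring
  · push_cast; ring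

theorem intervalIntegrable_comp_add (hk : IsLICM k) (hh : 0 < h) (n : ℕ) :
    IntervalIntegrable (fun x => k (x + n * h)) volume 0 h := by
  have := (hk.intervalIntegrable (x := n * h) (y := n * h + h) (by positivity)
    (by positivity)).comp_add_right (n * h)
  simpa using this

theorem cellIntegral_antitone (hk : IsLICM k) (hh : 0 < h) : Antitone (cellIntegral k h) := by
  refine antitone_nat_of_succ_le fun n => ?_
  rw [cellIntegral_eq, cellIntegral_eq]
  refine intervalIntegral.integral_mono_on_of_le_Ioo hh.le (hk.intervalIntegrable_comp_add hh _)
    (hk.intervalIntegrable_comp_add hh _) fun x hx => ?_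
  have h1 : 0 < x := hx.1
  refine hk.isCompletelyMonotone.antitoneOn (show 0 < x + n * h by positivity)
    (show 0 < x + (n + 1 : ℕ) * h by positivity) ?_
  push_cast
  linarith

theorem cellIntegral_pos (hk : IsLICM k) (hpos : ∀ x, 0 < x → 0 < k x) (hh : 0 < h) (n : ℕ) :
    0 < cellIntegral k h n := by
  refine intervalIntegral.intervalIntegral_pos_of_pos_on
    (hk.intervalIntegrable (by positivity) (by positivity)) (fun x hx => hpos x ?_) ?_
  · exact lt_of_le_of_lt (by positivity) hx.1
  · push_cast; linarith

/-- The quadratic form of log-convexity is linear in `k`, hence survives integration over a cell.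
Its value at the minimizing `l` is the claim. -/
theorem cellIntegral_sq_le (hk : IsLICM k) (hpos : ∀ x, 0 < x → 0 < k x) (hh : 0 < h) (n : ℕ) :
    cellIntegral k h (n + 1) ^ 2 ≤ cellIntegral k h n * cellIntegral k h (n + 2) := by
  have key : ∀ l : ℝ, 0 ≤ l ^ 2 * cellIntegral k h n - 2 * l * cellIntegral k h (n + 1) +
      cellIntegral k h (n + 2) := by
    intro l
    have i0 := (hk.intervalIntegrable_comp_add hh n).const_mul (l ^ 2)
    have i1 := (hk.intervalIntegrable_comp_add hh (n + 1)).const_mul (2 * l)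
    have i2 := hk.intervalIntegrable_comp_add hh (n + 2)
    rw [cellIntegral_eq, cellIntegral_eq, cellIntegral_eq, ← intervalIntegral.integral_const_mul,
      ← intervalIntegral.integral_const_mul, ← intervalIntegral.integral_sub i0 i1,
      ← intervalIntegral.integral_add (i0.sub i1) i2]
    refine intervalIntegral.integral_nonneg_of_ae_restrict hh.le ?_
    filter_upwards [ae_restrict_of_ae (Measure.ae_ne volume (0 : ℝ)),
      ae_restrict_mem measurableSet_Icc] with x hx0 hx
    have h1 : 0 < x := lt_of_le_of_ne hx.1 hx0.symm
    have := hk.isCompletelyMonotone.quadratic_nonneg (show 0 < x + n * h by positivity) hh.le l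
    have e1 : x + n * h + h = x + (n + 1 : ℕ) * h := by push_cast; ring
    have e2 : x + n * h + 2 * h = x + (n + 2 : ℕ) * h := by push_cast; ring
    rwa [e1, e2] at this
  have h0 := hk.cellIntegral_pos hpos hh n
  have hq := key (cellIntegral k h (n + 1) / cellIntegral k h n)
  set A := cellIntegral k h n
  set B := cellIntegral k h (n + 1)
  have e : (B / A) ^ 2 * A - 2 * (B / A) * B = -(B ^ 2 / A) := by field_simp; ring
  rw [e] at hq
  have : B ^ 2 / A ≤ cellIntegral k h (n + 2) := by linarith
  rw [div_le_iff₀ h0] at this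
  linarith

end IsLICM

namespace IsLICM

variable {k : ℝ → ℝ} {h : ℝ}

theorem stepPartner_nonneg (hk : IsLICM k) (hpos : ∀ x, 0 < x → 0 < k x) (hh : 0 < h) (t : ℝ) :
    0 ≤ stepPartner k h t := by
  unfold stepPartner
  split_ifs
  · exact sonineSeq_nonneg (hk.cellIntegral_pos hpos hh) (hk.cellIntegral_antitone hh) _
  · exact le_rfl

theorem stepPartner_antitoneOn (hk : IsLICM k) (hpos : ∀ x, 0 < x → 0 < k x) (hh : 0 < h) :
    AntitoneOn (stepPartner k h) (Ioi 0) := by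
  intro x hx y hy hxy
  unfold stepPartner
  rw [if_pos (show 0 < x from hx), if_pos (show 0 < y from hy)]
  refine sonineSeq_antitone (hk.cellIntegral_pos hpos hh) (hk.cellIntegral_sq_le hpos hh) ?_
  exact Nat.floor_le_floor (by gcongr)

theorem stepPartner_le (hk : IsLICM k) (hpos : ∀ x, 0 < x → 0 < k x) (hh : 0 < h) (t : ℝ) :
    stepPartner k h t ≤ 1 / cellIntegral k h 0 := by
  unfold stepPartner
  split_ifs
  · rw [← sonineSeq_zero]
    exact sonineSeq_antitone (hk.cellIntegral_pos hpos hh) (hk.cellIntegral_sq_le hpos hh)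
      (Nat.zero_le _)
  · exact (one_div_pos.2 (hk.cellIntegral_pos hpos hh 0)).le

theorem measurable_stepPartner (k : ℝ → ℝ) (h : ℝ) : Measurable (stepPartner k h) := by
  unfold stepPartner
  refine Measurable.ite measurableSet_Ioi ?_ measurable_const
  exact (measurable_from_top (f := sonineSeq (cellIntegral k h))).comp
    (Nat.measurable_floor.comp (measurable_id.div_const h))

theorem abs_stepPartner_le (hk : IsLICM k) (hpos : ∀ x, 0 < x → 0 < k x) (hh : 0 < h) (t : ℝ) :
    |stepPartner k h t| ≤ 1 / cellIntegral k h 0 := by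
  rw [abs_of_nonneg (hk.stepPartner_nonneg hpos hh t)]
  exact hk.stepPartner_le hpos hh t

theorem intervalIntegrable_mul_stepPartner (hk : IsLICM k) (hpos : ∀ x, 0 < x → 0 < k x)
    (hh : 0 < h) (s : ℝ) {x y : ℝ} (hx : 0 ≤ x) (hy : 0 ≤ y) :
    IntervalIntegrable (fun x => k x * stepPartner k h (s - x)) volume x y := by
  have := hk.intervalIntegrable hx hy
  rw [intervalIntegrable_iff] at this ⊢
  exact this.mul_bdd (c := 1 / cellIntegral k h 0)
    ((measurable_stepPartner k h).comp (measurable_const.sub measurable_id)).aestronglyMeasurable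
    (ae_of_all _ fun t => hk.abs_stepPartner_le hpos hh _)

theorem intervalIntegrable_stepPartner (hk : IsLICM k) (hpos : ∀ x, 0 < x → 0 < k x)
    (hh : 0 < h) (x y : ℝ) : IntervalIntegrable (stepPartner k h) volume x y :=
  (intervalIntegrable_const (c := 1 / cellIntegral k h 0)).mono_fun
    (measurable_stepPartner k h).aestronglyMeasurable
    (ae_of_all _ fun t => (hk.abs_stepPartner_le hpos hh t).trans (le_abs_self _))

theorem integral_mul_stepPartner_grid (hk : IsLICM k) (hpos : ∀ x, 0 < x → 0 < k x)
    (hh : 0 < h) (n : ℕ) :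
    ∫ x in (0 : ℝ)..((n + 1 : ℕ) * h), k x * stepPartner k h ((n + 1 : ℕ) * h - x) = 1 := by
  have hsum := intervalIntegral.sum_integral_adjacent_intervals (μ := volume)
    (f := fun x => k x * stepPartner k h ((n + 1 : ℕ) * h - x)) (a := fun i : ℕ => (i : ℝ) * h)
    (n := n + 1) fun i _ => hk.intervalIntegrable_mul_stepPartner hpos hh _
      (by positivity) (by positivity)
  rw [Nat.cast_zero, zero_mul] at hsum
  rw [← hsum, ← sum_mul_sonineSeq (hk.cellIntegral_pos hpos hh 0).ne' n,
    ← Finset.sum_range_reflect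
      (fun j => cellIntegral k h (n - j) * sonineSeq (cellIntegral k h) j)]
  refine Finset.sum_congr rfl fun i hi => ?_
  have hin : i ≤ n := Nat.lt_succ_iff.1 (Finset.mem_range.1 hi)
  rw [show n - (n + 1 - 1 - i) = i by omega, show n + 1 - 1 - i = n - i by omega, cellIntegral,
    ← intervalIntegral.integral_mul_const]
  refine intervalIntegral.integral_congr_ae ?_
  -- The right end is dropped because in the last cell, `i = n`, the step function is evaluated
  -- there at `0`, where it is set to zero.
  filter_upwards [Measure.ae_ne volume ((i + 1 : ℕ) * h : ℝ)] with x hne hx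
  rw [uIoc_of_le (by push_cast; linarith)] at hx
  have hlt : x < (i + 1 : ℕ) * h := lt_of_le_of_ne hx.2 hne
  have hcast : ((n - i : ℕ) : ℝ) = n - i := Nat.cast_sub hin
  have hin' : (i : ℝ) ≤ n := by exact_mod_cast hin
  have h1 : ((n - i : ℕ) : ℝ) * h < (n + 1 : ℕ) * h - x := by
    rw [hcast]; push_cast at hlt ⊢; linarith
  have h2 : (n + 1 : ℕ) * h - x < ((n - i : ℕ) + 1 : ℝ) * h := by
    rw [hcast]; push_cast; linarith [hx.1]
  have h0 : 0 < (n + 1 : ℕ) * h - x := lt_of_le_of_lt (by positivity) h1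
  rw [stepPartner, if_pos h0, (Nat.floor_eq_iff (by positivity)).2
    ⟨(le_div_iff₀ hh).2 h1.le, (div_lt_iff₀ hh).2 h2⟩]

/-- For `nh ≤ s < (n+1)h`, monotonicity of the step function allows comparison with the exact value
`1` at the two neighbouring grid points. The error comes from one partial cell, where the step
function is at most `1 / cellIntegral k h 0`. -/
theorem integral_mul_stepPartner_mem (hk : IsLICM k) (hpos : ∀ x, 0 < x → 0 < k x)
    (hh : 0 < h) {s : ℝ} (hs : 0 ≤ s) :
    |(∫ x in (0 : ℝ)..s, k x * stepPartner k h (s - x)) - 1| ≤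
      cellIntegral k h ⌊s / h⌋₊ / cellIntegral k h 0 := by
  set n := ⌊s / h⌋₊ with hn
  have hc0 := hk.cellIntegral_pos hpos hh 0
  have hns : n * h ≤ s := (le_div_iff₀ hh).1 (Nat.floor_le (by positivity))
  have hsn : s < (n + 1 : ℕ) * h := by
    have := (div_lt_iff₀ hh).1 (Nat.lt_floor_add_one (s / h))
    push_cast
    exact this
  have hn0 : 0 ≤ n * h := by positivity
  have tail : ∀ r x y : ℝ, n * h ≤ x → x ≤ y → y ≤ (n + 1 : ℕ) * h →
      ∫ x in x..y, k x * stepPartner k h (r - x) ≤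
        cellIntegral k h n / cellIntegral k h 0 := by
    intro r x y hx hxy hy
    have hx0 : 0 ≤ x := hn0.trans hx
    calc ∫ x in x..y, k x * stepPartner k h (r - x)
        ≤ ∫ x in x..y, k x * (1 / cellIntegral k h 0) := by
          refine intervalIntegral.integral_mono_on_of_le_Ioo hxy
            (hk.intervalIntegrable_mul_stepPartner hpos hh _ hx0 (hx0.trans hxy))
            ((hk.intervalIntegrable hx0 (hx0.trans hxy)).mul_const _) fun z hz => ?_
          exact mul_le_mul_of_nonneg_left (hk.stepPartner_le hpos hh _)
            (hpos z (hx0.trans_lt hz.1)).le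
      _ = (∫ x in x..y, k x) * (1 / cellIntegral k h 0) :=
          intervalIntegral.integral_mul_const _ _
      _ ≤ cellIntegral k h n * (1 / cellIntegral k h 0) := by
          refine mul_le_mul_of_nonneg_right ?_ (one_div_pos.2 hc0).le
          refine intervalIntegral.integral_mono_interval hx hxy hy ?_
            (hk.intervalIntegrable hn0 (by positivity))
          filter_upwards [ae_restrict_mem measurableSet_Ioc] with z hz
          exact (hpos z (hn0.trans_lt hz.1)).le
      _ = _ := by ring
  have hII := fun (r : ℝ) {x y : ℝ} (hx : 0 ≤ x) (hy : 0 ≤ y) =>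
    hk.intervalIntegrable_mul_stepPartner hpos hh r hx hy
  have upper : ∫ x in (0 : ℝ)..s, k x * stepPartner k h (s - x) ≤
      1 + cellIntegral k h n / cellIntegral k h 0 := by
    rw [← intervalIntegral.integral_add_adjacent_intervals (hII s le_rfl hn0) (hII s hn0 hs)]
    refine add_le_add ?_ (tail s _ _ le_rfl hns hsn.le)
    rcases Nat.eq_zero_or_pos n with h0 | h0
    · simp [h0]
    obtain ⟨m, hm⟩ : ∃ m, n = m + 1 := ⟨n - 1, by omega⟩
    rw [← hk.integral_mul_stepPartner_grid hpos hh m, ← hm]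
    refine intervalIntegral.integral_mono_on_of_le_Ioo hn0 (hII _ le_rfl hn0) (hII _ le_rfl hn0)
      fun z hz => ?_
    refine mul_le_mul_of_nonneg_left ?_ (hpos z hz.1).le
    exact hk.stepPartner_antitoneOn hpos hh (show 0 < n * h - z by linarith [hz.2])
      (show 0 < s - z by linarith [hz.2]) (by linarith)
  have lower : 1 ≤ (∫ x in (0 : ℝ)..s, k x * stepPartner k h (s - x)) +
      cellIntegral k h n / cellIntegral k h 0 := by
    rw [← hk.integral_mul_stepPartner_grid hpos hh n,
      ← intervalIntegral.integral_add_adjacent_intervals (hII _ le_rfl hs)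
        (hII _ hs (by positivity))]
    refine add_le_add ?_ (tail _ _ _ hns hsn.le le_rfl)
    refine intervalIntegral.integral_mono_on_of_le_Ioo hs (hII _ le_rfl hs) (hII _ le_rfl hs)
      fun z hz => ?_
    refine mul_le_mul_of_nonneg_left ?_ (hpos z hz.1).le
    exact hk.stepPartner_antitoneOn hpos hh (show 0 < s - z by linarith [hz.2])
      (show 0 < (n + 1 : ℕ) * h - z by linarith [hz.2]) (by linarith)
  rw [abs_le]
  constructor <;> linarith

theorem abs_integral_mul_stepPartner_le (hk : IsLICM k) (hpos : ∀ x, 0 < x → 0 < k x)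
    (hh : 0 < h) {s : ℝ} (hs : 0 ≤ s) :
    |∫ x in (0 : ℝ)..s, k x * stepPartner k h (s - x)| ≤ 2 := by
  have h1 := hk.integral_mul_stepPartner_mem hpos hh hs
  have h2 : cellIntegral k h ⌊s / h⌋₊ / cellIntegral k h 0 ≤ 1 :=
    (div_le_one (hk.cellIntegral_pos hpos hh 0)).2 (hk.cellIntegral_antitone hh (Nat.zero_le _))
  have := abs_le.1 (h1.trans h2)
  exact abs_le.2 ⟨by linarith, by linarith⟩

/-- For `h < s/2` the error ratio is at most `k(s/2) / k(h)`, which tends to `0` because `k` blows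
up at the origin. -/
theorem tendsto_integral_mul_stepPartner (hk : IsLICM k) (hpos : ∀ x, 0 < x → 0 < k x)
    (htop : Filter.Tendsto k (nhdsWithin 0 (Ioi 0)) Filter.atTop) {s : ℝ} (hs : 0 < s) :
    Filter.Tendsto (fun h => ∫ x in (0 : ℝ)..s, k x * stepPartner k h (s - x))
      (nhdsWithin 0 (Ioi 0)) (nhds 1) := by
  have hlim : Filter.Tendsto (fun h => k (s / 2) / k h) (nhdsWithin 0 (Ioi 0)) (nhds 0) :=
    htop.const_div_atTop _
  rw [tendsto_iff_dist_tendsto_zero]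
  refine squeeze_zero' (Filter.Eventually.of_forall fun _ => dist_nonneg) ?_ hlim
  filter_upwards [Ioo_mem_nhdsGT (show 0 < s / 2 by positivity)] with h hh'
  obtain ⟨hh, hh2⟩ := hh'
  refine (hk.integral_mul_stepPartner_mem hpos hh hs.le).trans ?_
  set n := ⌊s / h⌋₊
  have hcm := hk.isCompletelyMonotone
  have hsn : s < (n + 1 : ℕ) * h := by
    have := (div_lt_iff₀ hh).1 (Nat.lt_floor_add_one (s / h))
    push_cast
    exact this
  have hns : s / 2 ≤ n * h := by push_cast at hsn; linarith
  have hle : cellIntegral k h n ≤ h * k (s / 2) := by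
    rw [cellIntegral_eq]
    calc ∫ x in (0 : ℝ)..h, k (x + n * h) ≤ ∫ x in (0 : ℝ)..h, k (s / 2) := by
          refine intervalIntegral.integral_mono_on_of_le_Ioo hh.le
            (hk.intervalIntegrable_comp_add hh n) (by simp) fun x hx => ?_
          exact hcm.antitoneOn (show 0 < s / 2 by positivity)
            (show 0 < x + n * h by linarith [hx.1]) (by linarith [hx.1])
      _ = _ := by simp
  have hge : h * k h ≤ cellIntegral k h 0 := by
    have hi := hk.intervalIntegrable_comp_add hh 0
    rw [cellIntegral_eq]
    calc h * k h = ∫ x in (0 : ℝ)..h, k h := by simp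
      _ ≤ _ := by
          refine intervalIntegral.integral_mono_on_of_le_Ioo hh.le (by simp) hi fun x hx => ?_
          rw [Nat.cast_zero, zero_mul, add_zero]
          exact hcm.antitoneOn hx.1 hh hx.2.le
  have hkh := hpos h hh
  calc cellIntegral k h n / cellIntegral k h 0 ≤ (h * k (s / 2)) / (h * k h) :=
        div_le_div₀ (by have := hpos (s / 2) (by positivity); positivity) hle (by positivity) hge
    _ = _ := by field_simp

end IsLICM

/-! ### Sign and size of an arbitrary Sonine partner -/

namespace IsLICM

variable {k K : ℝ → ℝ} {b : ℝ}

open scoped Convolution in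
/-- Convolving `K` with `k * stepPartner k h` returns the primitive of `stepPartner k h`. -/
theorem integral_stepPartner_eq (hk : IsLICM k) (hpos : ∀ x, 0 < x → 0 < k x)
    (hK : IsCSCAssociated b k K) {h : ℝ} (hh : 0 < h) {t : ℝ} (ht : 0 < t) (htb : t ≤ b) :
    ∫ u in (0 : ℝ)..t, stepPartner k h u =
      ∫ u in (0 : ℝ)..t, K u * ∫ x in (0 : ℝ)..(t - u), k x * stepPartner k h (t - u - x) := by
  obtain ⟨hki, hKi, hconv⟩ := hK
  set f := (Ioo 0 b).indicator K
  set g := (Ioo 0 b).indicator k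
  have hf : Integrable f := hKi.integrable_indicator measurableSet_Ioo
  have hg : Integrable g := hki.integrable_indicator measurableSet_Ioo
  have hf0 : ∀ x ≤ 0, f x = 0 := fun x hx => indicator_of_notMem (fun h => not_lt.2 hx h.1) _
  have hg0 : ∀ x ≤ 0, g x = 0 := fun x hx => indicator_of_notMem (fun h => not_lt.2 hx h.1) _
  have hfe : ∀ x ∈ Ioo 0 b, f x = K x := fun x hx => indicator_of_mem hx _
  have hge : ∀ x ∈ Ioo 0 b, g x = k x := fun x hx => indicator_of_mem hx _
  have he0 : ∀ x ≤ 0, stepPartner k h x = 0 := fun x hx => if_neg (not_lt.2 hx)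
  have h1 : ∀ y ∈ Ioo 0 t, (f ⋆[ContinuousLinearMap.mul ℝ ℝ, volume] g) y = 1 := by
    intro y hy
    have hflip := intervalIntegral.integral_comp_sub_left (a := 0) (b := y)
      (fun s => K (y - s) * k s) y
    simp only [sub_zero, sub_self, sub_sub_cancel] at hflip
    rw [convolution_eq_intervalIntegral hf0 hg0 hy.1.le, ← hconv y hy.1 (hy.2.le.trans htb),
      ← hflip, intervalIntegral.integral_of_le hy.1.le, intervalIntegral.integral_of_le hy.1.le,
      integral_Ioc_eq_integral_Ioo, integral_Ioc_eq_integral_Ioo]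
    refine setIntegral_congr_fun measurableSet_Ioo fun s hs => ?_
    rw [hfe s ⟨hs.1, by linarith [hs.2, hy.2]⟩,
      hge (y - s) ⟨by linarith [hs.2], by linarith [hs.1, hy.2]⟩]
  have h2 : ∀ y ∈ Ioo 0 t, (g ⋆[ContinuousLinearMap.mul ℝ ℝ, volume] stepPartner k h) y =
      ∫ x in (0 : ℝ)..y, k x * stepPartner k h (y - x) := by
    intro y hy
    rw [convolution_eq_intervalIntegral hg0 he0 hy.1.le]
    rw [intervalIntegral.integral_of_le hy.1.le, intervalIntegral.integral_of_le hy.1.le]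
    refine setIntegral_congr_fun measurableSet_Ioc fun s hs => ?_
    rw [hge s ⟨hs.1, by linarith [hs.2, hy.2]⟩]
  have hfg0 : ∀ (p q : ℝ → ℝ), (∀ x ≤ 0, p x = 0) → (∀ x ≤ 0, q x = 0) →
      ∀ x ≤ 0, (p ⋆[ContinuousLinearMap.mul ℝ ℝ, volume] q) x = 0 := by
    intro p q hp hq x hx
    refine integral_eq_zero_of_ae (ae_of_all _ fun s => ?_)
    rcases le_or_gt s 0 with hs | hs
    · simp [hp s hs]
    · simp [hq (x - s) (by linarith)]
  -- In `(K * k) * e = K * (k * e)` the left side is the primitive of `e`, since `K * k = 1` on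
  -- `(0,t)`.
  have hassoc := convolution_assoc_of_bounded hf hg (measurable_stepPartner k h)
    (hk.abs_stepPartner_le hpos hh) t
  rw [convolution_eq_intervalIntegral (hfg0 _ _ hf0 hg0) he0 ht.le,
    convolution_eq_intervalIntegral hf0 (hfg0 _ _ hg0 he0) ht.le] at hassoc
  have e1 : ∫ u in (0 : ℝ)..t, stepPartner k h u =
      ∫ u in (0 : ℝ)..t, (f ⋆[ContinuousLinearMap.mul ℝ ℝ, volume] g) u *
        stepPartner k h (t - u) := by
    have := intervalIntegral.integral_comp_sub_left (a := 0) (b := t) (stepPartner k h) t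
    rw [sub_self, sub_zero] at this
    rw [← this, intervalIntegral.integral_of_le ht.le, intervalIntegral.integral_of_le ht.le,
      integral_Ioc_eq_integral_Ioo, integral_Ioc_eq_integral_Ioo]
    refine setIntegral_congr_fun measurableSet_Ioo fun s hs => ?_
    rw [h1 s hs, one_mul]
  rw [e1, hassoc, intervalIntegral.integral_of_le ht.le, intervalIntegral.integral_of_le ht.le,
    integral_Ioc_eq_integral_Ioo, integral_Ioc_eq_integral_Ioo]
  refine setIntegral_congr_fun measurableSet_Ioo fun s hs => ?_
  rw [hfe s ⟨hs.1, by linarith [hs.2]⟩, h2 (t - s) ⟨by linarith [hs.2], by linarith [hs.1]⟩]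

open scoped Convolution in
theorem aestronglyMeasurable_integral_mul_stepPartner (hk : IsLICM k) (h t : ℝ) :
    AEStronglyMeasurable
      (fun u => ∫ x in (0 : ℝ)..(t - u), k x * stepPartner k h (t - u - x))
      (volume.restrict (Ioc 0 t)) := by
  have hkm : AEStronglyMeasurable ((Ioi 0).indicator k) volume :=
    (aestronglyMeasurable_indicator_iff measurableSet_Ioi).2
      (hk.1.continuousOn.aestronglyMeasurable measurableSet_Ioi)
  have hm : AEStronglyMeasurable ((Ioi 0).indicator k ⋆[ContinuousLinearMap.mul ℝ ℝ, volume]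
      stepPartner k h) volume :=
    (AEStronglyMeasurable.convolution_integrand (ContinuousLinearMap.mul ℝ ℝ) hkm
      (measurable_stepPartner k h).aestronglyMeasurable).integral_prod_right'
  refine (hm.comp_quasiMeasurePreserving
    (quasiMeasurePreserving_sub_left_of_right_invariant volume t)).restrict.congr ?_
  filter_upwards [ae_restrict_mem measurableSet_Ioc] with u hu
  have hk0 : ∀ x ≤ 0, (Ioi 0).indicator k x = 0 := fun x hx =>
    indicator_of_notMem (not_lt.2 hx) _
  have he0 : ∀ x ≤ 0, stepPartner k h x = 0 := fun x hx => if_neg (not_lt.2 hx)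
  rw [Function.comp_apply, convolution_eq_intervalIntegral hk0 he0 (sub_nonneg.2 hu.2), intervalIntegral.integral_of_le (sub_nonneg.2 hu.2),
    intervalIntegral.integral_of_le (sub_nonneg.2 hu.2)]
  refine setIntegral_congr_fun measurableSet_Ioc fun s hs => ?_
  rw [indicator_of_mem (show s ∈ Ioi 0 from hs.1)]

theorem intervalIntegrable_partner (hb : 0 < b) (hK : IsCSCAssociated b k K) {x y : ℝ}
    (hx : x ∈ Icc 0 b) (hy : y ∈ Icc 0 b) : IntervalIntegrable K volume x y := by
  have h : IntervalIntegrable K volume 0 b := by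
    rw [intervalIntegrable_iff_integrableOn_Ioo_of_le hb.le]
    exact hK.2.1
  refine h.mono_set ?_
  rw [uIcc_of_le hb.le]
  exact uIcc_subset_Icc hx hy

/-- Since `k * e_h` is bounded by `2` and tends to `1`, dominated convergence against `|K|` applies;
no compactness argument for `e_h` is needed. -/
theorem tendsto_integral_stepPartner (hk : IsLICM k) (hb : 0 < b)
    (hK : IsCSCAssociated b k K) {t : ℝ} (ht : 0 < t) (htb : t ≤ b) :
    Filter.Tendsto (fun h => ∫ u in (0 : ℝ)..t, stepPartner k h u)
      (nhdsWithin 0 (Ioi 0)) (nhds (∫ u in (0 : ℝ)..t, K u)) := by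
  have hpos : ∀ x, 0 < x → 0 < k x := fun x hx => hk.pos hb hK hx
  have htop := hk.tendsto_atTop hb hK
  have hKt := intervalIntegrable_partner hb hK (x := 0) (y := t) ⟨le_rfl, hb.le⟩ ⟨ht.le, htb⟩
  have hlim : Filter.Tendsto (fun h => ∫ u in (0 : ℝ)..t,
      K u * ∫ x in (0 : ℝ)..(t - u), k x * stepPartner k h (t - u - x))
      (nhdsWithin 0 (Ioi 0)) (nhds (∫ u in (0 : ℝ)..t, K u * 1)) := by
    refine intervalIntegral.tendsto_integral_filter_of_dominated_convergence
      (fun u => |K u| * 2) ?_ ?_ (hKt.abs.mul_const 2) ?_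
    · filter_upwards [self_mem_nhdsWithin] with h hh
      have hKm := hKt.aestronglyMeasurable
      rw [uIoc_of_le ht.le]
      exact hKm.mul (hk.aestronglyMeasurable_integral_mul_stepPartner h t)
    · filter_upwards [self_mem_nhdsWithin] with h hh
      refine ae_of_all _ fun u hu => ?_
      rw [uIoc_of_le ht.le] at hu
      rw [norm_mul]
      exact mul_le_mul_of_nonneg_left
        (hk.abs_integral_mul_stepPartner_le hpos hh (by linarith [hu.2])) (abs_nonneg _)
    · filter_upwards [Measure.ae_ne volume t] with u hut hu
      rw [uIoc_of_le ht.le] at hu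
      exact (hk.tendsto_integral_mul_stepPartner hpos htop
        (sub_pos.2 (lt_of_le_of_ne hu.2 hut))).const_mul _
  simp only [mul_one] at hlim
  refine hlim.congr' ?_
  filter_upwards [self_mem_nhdsWithin] with h hh
  exact (hk.integral_stepPartner_eq hpos hK hh ht htb).symm

theorem integral_partner_mono (hk : IsLICM k) (hb : 0 < b) (hK : IsCSCAssociated b k K)
    {x y : ℝ} (hx : 0 < x) (hxy : x ≤ y) (hy : y ≤ b) :
    ∫ u in (0 : ℝ)..x, K u ≤ ∫ u in (0 : ℝ)..y, K u := by
  have hpos : ∀ x, 0 < x → 0 < k x := fun x hx => hk.pos hb hK hx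
  refine le_of_tendsto_of_tendsto (hk.tendsto_integral_stepPartner hb hK hx (hxy.trans hy))
    (hk.tendsto_integral_stepPartner hb hK (hx.trans_le hxy) hy) ?_
  filter_upwards [self_mem_nhdsWithin] with h hh
  exact intervalIntegral.integral_mono_interval le_rfl hx.le hxy
    (ae_of_all _ fun t => hk.stepPartner_nonneg hpos hh t)
    (hk.intervalIntegrable_stepPartner hpos hh _ _)

/-- A nonincreasing density is, beyond `x`, at most its value at `x`, which is at most its mean over
`(0,x)`. This holds for the step functions and passes to the limit. -/
theorem integral_partner_sub_le (hk : IsLICM k) (hb : 0 < b) (hK : IsCSCAssociated b k K)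
    {x y : ℝ} (hx : 0 < x) (hxy : x ≤ y) (hy : y ≤ b) :
    (∫ u in (0 : ℝ)..y, K u) - ∫ u in (0 : ℝ)..x, K u ≤
      (y - x) * ((∫ u in (0 : ℝ)..x, K u) / x) := by
  have hpos : ∀ x, 0 < x → 0 < k x := fun x hx => hk.pos hb hK hx
  have hlx := hk.tendsto_integral_stepPartner hb hK hx (hxy.trans hy)
  refine le_of_tendsto_of_tendsto ((hk.tendsto_integral_stepPartner hb hK (hx.trans_le hxy) hy).sub
    hlx) ((hlx.div_const x).const_mul (y - x)) ?_
  filter_upwards [self_mem_nhdsWithin] with h hh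
  have hii := hk.intervalIntegrable_stepPartner hpos hh
  have hanti := hk.stepPartner_antitoneOn hpos hh
  rw [intervalIntegral.integral_interval_sub_left (hii _ _) (hii _ _)]
  calc ∫ u in x..y, stepPartner k h u ≤ ∫ u in x..y, stepPartner k h x := by
        refine intervalIntegral.integral_mono_on hxy (hii _ _) (by simp) fun u hu => ?_
        exact hanti hx (show 0 < u from hx.trans_le hu.1) hu.1
    _ = (y - x) * stepPartner k h x := by simp
    _ ≤ _ := by
        refine mul_le_mul_of_nonneg_left ?_ (by linarith)
        rw [le_div_iff₀ hx]
        calc stepPartner k h x * x = ∫ u in (0 : ℝ)..x, stepPartner k h x := by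
              simp [mul_comm]
          _ ≤ _ := by
              refine intervalIntegral.integral_mono_on_of_le_Ioo hx.le (by simp) (hii _ _)
                fun u hu => ?_
              exact hanti hu.1 hx hu.2.le

/-- A Sonine partner of `k` is nonnegative and bounded away from `0`. -/
theorem partner_ae_mem (hk : IsLICM k) (hb : 0 < b) (hK : IsCSCAssociated b k K) :
    ∃ C, ∀ᵐ t, t ∈ Ioo 0 b → 0 ≤ K t ∧ K t ≤ C / t := by
  refine ⟨∫ u in (0 : ℝ)..b, K u, ?_⟩
  have hKb := intervalIntegrable_partner hb hK (x := 0) (y := b) ⟨le_rfl, hb.le⟩ ⟨hb.le, le_rfl⟩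
  -- By Lebesgue differentiation `K t` is almost everywhere the limit of right slopes of its
  -- primitive, and the two preceding inequalities bound those slopes.
  filter_upwards [hKb.ae_hasDerivAt_integral] with t ht htm
  have hd := ht (by rw [uIcc_of_le hb.le]; exact Ioo_subset_Icc_self htm) 0 (by simp)
  have hs := hd.hasDerivWithinAt (s := Ioi t)
  rw [hasDerivWithinAt_iff_tendsto_slope' (by simp)] at hs
  have hev : ∀ᶠ y in nhdsWithin t (Ioi t), y ∈ Ioo t b := Ioo_mem_nhdsGT htm.2
  constructor
  · refine ge_of_tendsto hs ?_
    filter_upwards [hev] with y hy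
    rw [slope_def_field]
    exact div_nonneg (sub_nonneg.2 (hk.integral_partner_mono hb hK htm.1 hy.1.le hy.2.le))
      (by linarith [hy.1])
  · refine le_of_tendsto hs ?_
    filter_upwards [hev] with y hy
    rw [slope_def_field, div_le_iff₀ (by linarith [hy.1])]
    refine (hk.integral_partner_sub_le hb hK htm.1 hy.1.le hy.2.le).trans ?_
    rw [mul_comm]
    refine mul_le_mul_of_nonneg_right ?_ (by linarith [hy.1])
    exact div_le_div_of_nonneg_right (hk.integral_partner_mono hb hK htm.1 htm.2.le le_rfl)
      htm.1.le

end IsLICM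

/-! ### Differentiating an integral against the singular kernel `k` -/

theorem indicator_Ioi_zero_of_nonpos (f : ℝ → ℝ) {x : ℝ} (hx : x ≤ 0) :
    (Ioi (0 : ℝ)).indicator f x = 0 :=
  indicator_of_notMem (not_lt.2 hx) f

/-- A product is integrable if the first factor is integrable on `(-∞,a)`, bounded on `[a,∞)`, and
the second one is integrable and bounded on `(-∞,a)`. -/
theorem integrable_mul_of_bounded_split {p m : ℝ → ℝ} {a C M : ℝ} (hp : IntegrableOn p (Iio a))
    (hpm : AEStronglyMeasurable p volume) (hpM : ∀ x, a ≤ x → |p x| ≤ M) (hm : Integrable m)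
    (hmC : ∀ᵐ x, x < a → |m x| ≤ C) : Integrable (fun x => p x * m x) := by
  rw [← integrableOn_univ, ← Iio_union_Ici (a := a)]
  refine IntegrableOn.union ?_ ?_
  · refine hp.mul_bdd (c := C) hm.1.restrict ?_
    rw [ae_restrict_iff' measurableSet_Iio]
    exact hmC
  · refine hm.integrableOn.bdd_mul (c := M) hpm.restrict ?_
    rw [ae_restrict_iff' measurableSet_Ici]
    exact ae_of_all _ hpM

namespace IsLICM

variable {k : ℝ → ℝ}

theorem aestronglyMeasurable_indicator (hk : IsLICM k) :
    AEStronglyMeasurable ((Ioi 0).indicator k) volume :=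
  (aestronglyMeasurable_indicator_iff measurableSet_Ioi).2
    (hk.1.continuousOn.aestronglyMeasurable measurableSet_Ioi)

theorem integrableOn_indicator_Iio (hk : IsLICM k) (T : ℝ) :
    IntegrableOn ((Ioi 0).indicator k) (Iio T) := by
  rw [IntegrableOn, integrable_indicator_iff measurableSet_Ioi, IntegrableOn,
    Measure.restrict_restrict measurableSet_Ioi, Ioi_inter_Iio]
  rcases le_or_gt T 0 with h | h
  · simp [Ioo_eq_empty (not_lt.2 h)]
  · exact hk.2.2 T h

theorem indicator_nonneg (hk : IsLICM k) (x : ℝ) : 0 ≤ (Ioi 0).indicator k x :=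
  Set.indicator_nonneg (fun _ hx => hk.isCompletelyMonotone.nonneg hx) x

theorem abs_indicator_le (hk : IsLICM k) {a x : ℝ} (ha : 0 < a) (hx : a ≤ x) :
    |(Ioi 0).indicator k x| ≤ k a := by
  rw [abs_of_nonneg (hk.indicator_nonneg x), indicator_of_mem (show x ∈ Ioi 0 from ha.trans_le hx)]
  exact hk.isCompletelyMonotone.antitoneOn ha (show 0 < x from ha.trans_le hx) hx

theorem integrableOn_indicator_comp_add (hk : IsLICM k) (y T : ℝ) :
    IntegrableOn (fun x => (Ioi 0).indicator k (x + y)) (Iio T) := by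
  have h := (hk.integrableOn_indicator_Iio (T + y))
  rw [← integrable_indicator_iff measurableSet_Iio] at h ⊢
  refine (h.comp_add_right y).congr (ae_of_all _ fun x => ?_)
  simp [indicator_apply]

theorem integrableOn_indicator_comp_div (hk : IsLICM k) {c : ℝ} (hc : 0 < c) (T : ℝ) :
    IntegrableOn (fun x => (Ioi 0).indicator k (x / c)) (Iio T) := by
  have h := (hk.integrableOn_indicator_Iio (T / c))
  rw [← integrable_indicator_iff measurableSet_Iio] at h ⊢
  refine (h.comp_div hc.ne').congr (ae_of_all _ fun x => ?_)
  simp [indicator_apply, div_lt_div_iff_of_pos_right hc]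

theorem integrable_indicator_comp_add_mul (hk : IsLICM k) {m : ℝ → ℝ} {a C y : ℝ}
    (hm : Integrable m) (hmC : ∀ᵐ x, x < a → |m x| ≤ C) (hy : 0 < a + y) :
    Integrable (fun x => (Ioi 0).indicator k (x + y) * m x) :=
  integrable_mul_of_bounded_split (hk.integrableOn_indicator_comp_add y a)
    (hk.aestronglyMeasurable_indicator.comp_quasiMeasurePreserving
      (measurePreserving_add_right volume y).quasiMeasurePreserving)
    (fun x hx => hk.abs_indicator_le hy (by linarith)) hm hmC

theorem integrable_indicator_comp_div_mul (hk : IsLICM k) {m : ℝ → ℝ} {a C c : ℝ}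
    (hm : Integrable m) (hmC : ∀ᵐ x, x < a → |m x| ≤ C) (ha : 0 < a) (hc : 0 < c) :
    Integrable (fun x => (Ioi 0).indicator k (x / c) * m x) :=
  integrable_mul_of_bounded_split (hk.integrableOn_indicator_comp_div hc a)
    (by
      have h := hk.aestronglyMeasurable_indicator.comp_quasiMeasurePreserving
        (Measure.quasiMeasurePreserving_smul (volume : Measure ℝ) (inv_ne_zero hc.ne'))
      refine h.congr (ae_of_all _ fun x => ?_)
      simp [div_eq_inv_mul])
    (fun x hx => hk.abs_indicator_le (div_pos ha hc) (div_le_div_of_nonneg_right hx hc.le)) hm hmC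

/-- The difference quotient of `k`, extended by zero, away from the origin. -/
theorem mul_abs_sub_indicator_le (hk : IsLICM k) {x y : ℝ} (hy : y ≠ 0) (hxy : 2 * |y| ≤ |x|) :
    |x| * |(Ioi 0).indicator k (x + y) - (Ioi 0).indicator k x| ≤
      |y| * (4 * (Ioi 0).indicator k (x / 4)) := by
  have hcm := hk.isCompletelyMonotone
  have hy0 := abs_pos.2 hy
  have hya := abs_le.1 (le_refl |y|)
  rcases le_or_gt x 0 with hx | hx
  · rw [abs_of_nonpos hx] at hxy
    rw [indicator_Ioi_zero_of_nonpos k (by linarith : x + y ≤ 0),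
      indicator_Ioi_zero_of_nonpos k hx, indicator_Ioi_zero_of_nonpos k (by linarith : x / 4 ≤ 0)]
    simp
  · rw [abs_of_pos hx] at hxy ⊢
    have hxy0 : 0 < x + y := by linarith
    rw [indicator_of_mem (show x + y ∈ Ioi 0 from hxy0), indicator_of_mem (show x ∈ Ioi 0 from hx),
      indicator_of_mem (show x / 4 ∈ Ioi 0 from by simp only [mem_Ioi]; linarith)]
    have hd := hcm.mul_abs_deriv_le (show 0 < x / 2 by linarith)
    rw [abs_of_nonpos (hcm.deriv_nonpos (show 0 < x / 2 by linarith))] at hd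
    -- As `|y| ≤ x/2`, both points lie in `[x/2, ∞)`, where by convexity the slope is steepest at
    -- `x/2`.
    have hlip : ∀ p q : ℝ, x / 2 ≤ p → p ≤ q → |k p - k q| ≤ -deriv k (x / 2) * (q - p) := by
      intro p q hp hpq
      have hp0 : 0 < p := by linarith
      rw [abs_of_nonneg (sub_nonneg.2 (hcm.antitoneOn hp0 (show 0 < q by linarith) hpq))]
      refine (hcm.sub_le_neg_deriv_mul hp0 hpq).trans
        (mul_le_mul_of_nonneg_right (neg_le_neg ?_) (by linarith))
      exact hcm.monotoneOn_deriv (show 0 < x / 2 by linarith) hp0 hp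
    have hle : |k (x + y) - k x| ≤ -deriv k (x / 2) * |y| := by
      rcases le_total 0 y with h | h
      · rw [abs_sub_comm, abs_of_nonneg h]
        have := hlip x (x + y) (by linarith) (by linarith)
        rwa [add_sub_cancel_left] at this
      · rw [abs_of_nonpos h]
        have := hlip (x + y) x (by linarith) (by linarith)
        rwa [sub_add_cancel_left] at this
    calc x * |k (x + y) - k x| ≤ x * (-deriv k (x / 2) * |y|) :=
          mul_le_mul_of_nonneg_left hle hx.le
      _ = |y| * (2 * (x / 2 * -deriv k (x / 2))) := by ring
      _ ≤ |y| * (2 * (2 * k (x / 2 / 2))) := by gcongr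
      _ = _ := by rw [show x / 2 / 2 = x / 4 by ring]; ring

/-- Differentiation under the integral sign against a kernel that vanishes at the singularity. -/
theorem hasDerivAt_integral_indicator (hk : IsLICM k) {φ m : ℝ → ℝ} {a C T : ℝ} (ha : 0 < a)
    (hφ : AEStronglyMeasurable φ volume) (hm : Integrable m) (hmC : ∀ᵐ x, x < a → |m x| ≤ C)
    (hφm : ∀ x, |φ x| ≤ |x| * |m x|) (hT : ∀ x, T < x → φ x = 0) :
    HasDerivAt (fun y => ∫ x, φ x * (Ioi 0).indicator k (x + y))
      (∫ x, φ x * (Ioi 0).indicator (deriv k) x) 0 := by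
  set kt := (Ioi 0).indicator k
  have hktm := hk.aestronglyMeasurable_indicator
  have hcm := hk.isCompletelyMonotone
  have hktsm : ∀ y, AEStronglyMeasurable (fun x => kt (x + y)) volume := fun y =>
    hktm.comp_quasiMeasurePreserving (measurePreserving_add_right volume y).quasiMeasurePreserving
  have hint : ∀ y, |y| < a → Integrable (fun x => φ x * kt (x + y)) := by
    intro y hy
    have hya := abs_lt.1 hy
    refine ((hk.integrable_indicator_comp_add_mul hm.abs (C := C) (by simpa using hmC)
      (by linarith : 0 < a + y)).const_mul (|T| + a)).mono' (hφ.mul (hktsm y))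
      (ae_of_all _ fun x => ?_)
    have hnn := hk.indicator_nonneg (x + y)
    rw [norm_mul, Real.norm_eq_abs, Real.norm_of_nonneg hnn]
    rcases le_or_gt (x + y) 0 with h | h
    · rw [indicator_Ioi_zero_of_nonpos k h]
      simp
    rcases lt_or_ge T x with h' | h'
    · rw [hT x h', abs_zero, zero_mul]
      positivity
    -- The integrand is supported in `-y < x ≤ T`, and `|y| < a`.
    · have hx : |x| ≤ |T| + a := abs_le.2
        ⟨by linarith [abs_nonneg T], by linarith [le_abs_self T]⟩
      calc |φ x| * kt (x + y) ≤ (|T| + a) * |m x| * kt (x + y) :=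
            mul_le_mul_of_nonneg_right ((hφm x).trans
              (mul_le_mul_of_nonneg_right hx (abs_nonneg _))) hnn
        _ = _ := by ring
  rw [hasDerivAt_iff_tendsto_slope]
  set ψ : ℝ → ℝ → ℝ := fun y x => φ x * ((kt (x + y) - kt x) / y)
  have hψm : ∀ y, AEStronglyMeasurable (ψ y) volume := fun y =>
    hφ.mul
    ((((hktsm y).sub hktm).mul_const y⁻¹).congr (ae_of_all _ fun x => by
      simp [div_eq_mul_inv, kt]))
  have hψi : ∀ y, |y| < a → Integrable (ψ y) := by
    intro y hy
    have h0 := hint 0 (by simpa using ha)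
    simp only [add_zero] at h0
    refine (((hint y hy).sub h0).div_const y).congr (ae_of_all _ fun x => ?_)
    simp only [ψ, Pi.sub_apply]
    ring
  -- Split the difference quotient at `|x| = 2|y|`. The far part has the integrable majorant `4
  -- k(x/4) |m x|`. The near part contains the singularities of both `k(x)` and `k(x+y)` and is
  -- shown to vanish in the limit.
  have hslope : ∀ y, |y| < a → slope (fun y => ∫ x, φ x * kt (x + y)) 0 y =
      (∫ x in {x | 2 * |y| ≤ |x|}, ψ y x) + ∫ x in {x | 2 * |y| ≤ |x|}ᶜ, ψ y x := by
    intro y hy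
    have h0 := hint 0 (by simpa using ha)
    rw [integral_add_compl (measurableSet_le measurable_const measurable_abs) (hψi y hy),
      slope_def_field, ← integral_sub (hint y hy) h0, sub_zero, ← integral_div]
    refine integral_congr_ae (ae_of_all _ fun x => ?_)
    simp only [ψ, add_zero]
    ring
  have hsmall : ∀ᶠ y in nhdsWithin (0 : ℝ) {0}ᶜ, |y| < a / 2 ∧ y ≠ 0 := by
    refine Filter.Eventually.and (nhdsWithin_le_nhds ?_) self_mem_nhdsWithin
    exact continuous_abs.continuousAt.eventually_lt continuousAt_const (by simpa using ha)
  have hlim1 : Filter.Tendsto (fun y => ∫ x in {x | 2 * |y| ≤ |x|}, ψ y x)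
      (nhdsWithin 0 {0}ᶜ) (nhds (∫ x, φ x * (Ioi 0).indicator (deriv k) x)) := by
    have e : ∀ y, ∫ x in {x | 2 * |y| ≤ |x|}, ψ y x =
        ∫ x, ({x | 2 * |y| ≤ |x|}).indicator (ψ y) x := fun y =>
      (integral_indicator (measurableSet_le measurable_const measurable_abs)).symm
    simp only [e]
    refine tendsto_integral_filter_of_dominated_convergence
      (fun x => 4 * (kt (x / 4) * |m x|)) ?_ ?_ ?_ ?_
    · exact Filter.Eventually.of_forall fun y =>
        (hψm y).indicator (measurableSet_le measurable_const measurable_abs)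
    · filter_upwards [hsmall] with y hy
      refine ae_of_all _ fun x => ?_
      have hnn := mul_nonneg (hk.indicator_nonneg (x / 4)) (abs_nonneg (m x))
      by_cases hx : 2 * |y| ≤ |x|
      · rw [indicator_of_mem (by exact hx)]
        have h1 := hk.mul_abs_sub_indicator_le hy.2 hx
        have hy0 := abs_pos.2 hy.2
        simp only [ψ, norm_mul, norm_div, Real.norm_eq_abs]
        rw [← mul_div_assoc, div_le_iff₀ hy0]
        calc |φ x| * |kt (x + y) - kt x| ≤ |x| * |m x| * |kt (x + y) - kt x| :=
              mul_le_mul_of_nonneg_right (hφm x) (abs_nonneg _)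
          _ = |m x| * (|x| * |kt (x + y) - kt x|) := by ring
          _ ≤ |m x| * (|y| * (4 * kt (x / 4))) := mul_le_mul_of_nonneg_left h1 (abs_nonneg _)
          _ = _ := by ring
      · rw [indicator_of_notMem (by exact hx), norm_zero]
        positivity
    · exact (hk.integrable_indicator_comp_div_mul hm.abs (C := C) (by simpa using hmC) ha
        (by norm_num)).const_mul 4
    · filter_upwards [Measure.ae_ne volume (0 : ℝ)] with x hx
      have hev : ∀ᶠ y in nhdsWithin (0 : ℝ) {0}ᶜ, 2 * |y| ≤ |x| := by
        refine nhdsWithin_le_nhds ?_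
        have : Filter.Tendsto (fun y : ℝ => 2 * |y|) (nhds 0) (nhds 0) := by
          have : Continuous fun y : ℝ => 2 * |y| := by fun_prop
          simpa using this.tendsto 0
        exact (this.eventually_lt_const (abs_pos.2 hx)).mono fun _ h => h.le
      have hder : HasDerivAt kt ((Ioi 0).indicator (deriv k) x) x := by
        rcases lt_or_gt_of_ne hx with h | h
        · rw [indicator_Ioi_zero_of_nonpos _ h.le]
          refine (hasDerivAt_const x (0 : ℝ)).congr_of_eventuallyEq ?_
          filter_upwards [Iio_mem_nhds h] with z hz
          exact indicator_Ioi_zero_of_nonpos k (le_of_lt hz)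
        · rw [indicator_of_mem (show x ∈ Ioi 0 from h)]
          refine (hcm.hasDerivAt h).congr_of_eventuallyEq ?_
          filter_upwards [Ioi_mem_nhds h] with z hz
          exact indicator_of_mem hz _
      have ht := (hasDerivAt_iff_tendsto_slope_zero.1 hder).const_mul (φ x)
      refine ht.congr' ?_
      filter_upwards [hev] with y hy
      rw [indicator_of_mem (by exact hy)]
      simp only [ψ, smul_eq_mul]
      ring
  have hli : ∀ p q, IntervalIntegrable kt volume p q := fun p q =>
    intervalIntegrable_iff.2 <| (hk.integrableOn_indicator_Iio (max p q + 1)).mono_set fun x hx => by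
      have := hx.2
      simp only [mem_Iio]
      linarith
  have hprim : Continuous fun r : ℝ => ∫ x in (-r)..r, kt x := by
    have hc := intervalIntegral.continuous_primitive hli 0
    have : (fun r : ℝ => ∫ x in (-r)..r, kt x) =
        fun r => (∫ x in (0 : ℝ)..r, kt x) - ∫ x in (0 : ℝ)..(-r), kt x := by
      ext r
      rw [intervalIntegral.integral_interval_sub_left (hli _ _) (hli _ _)]
    rw [this]
    exact hc.sub (hc.comp continuous_neg)
  have hlim2 : Filter.Tendsto (fun y => ∫ x in {x | 2 * |y| ≤ |x|}ᶜ, ψ y x)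
      (nhdsWithin 0 {0}ᶜ) (nhds 0) := by
    -- Near `0`, `|φ x| ≤ 2|y||C|` cancels the division by `y`. What remains is the mass of `k` on
    -- the window `|x| ≤ 2|y|` and on its translate by `y`, both inside `[-3|y|, 3|y|]`.
    have hbound : Filter.Tendsto (fun y => 4 * |C| * ∫ x in (-(3 * |y|))..(3 * |y|), kt x)
        (nhdsWithin 0 {0}ᶜ) (nhds 0) := by
      have h3 : Continuous fun y : ℝ => 3 * |y| := by fun_prop
      have := (continuous_const (y := 4 * |C|)).mul (hprim.comp h3)
      simpa [Pi.mul_def, Function.comp_def] using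
        (this.tendsto 0).mono_left (nhdsWithin_le_nhds (s := {0}ᶜ))
    refine squeeze_zero_norm' ?_ hbound
    filter_upwards [hsmall] with y hy
    have hy0 := abs_pos.2 hy.2
    have hya := abs_le.1 (le_refl |y|)
    have hset : {x : ℝ | 2 * |y| ≤ |x|}ᶜ = Ioo (-(2 * |y|)) (2 * |y|) := by
      ext x
      simp [abs_lt]
    have hle : -(2 * |y|) ≤ 2 * |y| := by linarith
    have hli' : IntervalIntegrable (fun x => kt (x + y)) volume (-(2 * |y|)) (2 * |y|) := by
      simpa using (hli (-(2 * |y|) + y) (2 * |y| + y)).comp_add_right y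
    rw [hset, ← integral_Ioc_eq_integral_Ioo, ← intervalIntegral.integral_of_le hle]
    have hmono : ∀ p q, -(3 * |y|) ≤ p → p ≤ q → q ≤ 3 * |y| →
        ∫ x in p..q, kt x ≤ ∫ x in (-(3 * |y|))..(3 * |y|), kt x := fun p q hp hpq hq =>
      intervalIntegral.integral_mono_interval hp hpq hq
        (ae_of_all _ fun x => hk.indicator_nonneg x) (hli _ _)
    calc ‖∫ x in (-(2 * |y|))..(2 * |y|), ψ y x‖
        ≤ ∫ x in (-(2 * |y|))..(2 * |y|), 2 * |C| * (kt (x + y) + kt x) := by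
          refine intervalIntegral.norm_integral_le_of_norm_le hle ?_
            ((hli'.add (hli _ _)).const_mul _)
          filter_upwards [hmC] with x hxC hx
          have hxa : |x| ≤ 2 * |y| := abs_le.2 ⟨hx.1.le, hx.2⟩
          have hmx : |m x| ≤ |C| := (hxC (by linarith [hx.2])).trans (le_abs_self C)
          have h1 := hk.indicator_nonneg (x + y)
          have h2 := hk.indicator_nonneg x
          have h3 : |kt (x + y) - kt x| ≤ kt (x + y) + kt x :=
            abs_le.2 ⟨by linarith, by linarith⟩
          simp only [ψ, norm_mul, norm_div, Real.norm_eq_abs]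
          rw [← mul_div_assoc, div_le_iff₀ hy0]
          calc |φ x| * |kt (x + y) - kt x|
              ≤ (2 * |y| * |C|) * (kt (x + y) + kt x) := by
                refine mul_le_mul ((hφm x).trans ?_) h3 (abs_nonneg _) (by positivity)
                exact mul_le_mul hxa hmx (abs_nonneg _) (by positivity)
            _ = _ := by ring
      _ = 2 * |C| * ((∫ x in (-(2 * |y|) + y)..(2 * |y| + y), kt x) +
            ∫ x in (-(2 * |y|))..(2 * |y|), kt x) := by
          rw [intervalIntegral.integral_const_mul,
            intervalIntegral.integral_add hli' (hli _ _),
            intervalIntegral.integral_comp_add_right]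
      _ ≤ 2 * |C| * ((∫ x in (-(3 * |y|))..(3 * |y|), kt x) +
            ∫ x in (-(3 * |y|))..(3 * |y|), kt x) := by
          refine mul_le_mul_of_nonneg_left (add_le_add (hmono _ _ ?_ ?_ ?_) (hmono _ _ ?_ ?_ ?_))
            (by positivity) <;> linarith
      _ = _ := by ring
  have := hlim1.add hlim2
  rw [add_zero] at this
  refine this.congr' ?_
  filter_upwards [hsmall] with y hy
  exact (hslope y (by linarith [hy.1])).symm

end IsLICM

/-! ### The weighted convolution for a Lipschitz weight -/

theorem IsCSCAssociated.integral_comp_sub {b : ℝ} {k K : ℝ → ℝ} (hK : IsCSCAssociated b k K)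
    {t : ℝ} (ht : 0 < t) (htb : t ≤ b) : ∫ z in (0 : ℝ)..t, k (t - z) * K z = 1 := by
  have h := intervalIntegral.integral_comp_sub_left (a := 0) (b := t)
    (fun s => K (t - s) * k s) t
  simp only [sub_zero, sub_self, sub_sub_cancel] at h
  rw [← hK.2.2 t ht htb, ← h]
  simp only [mul_comm]

/-- A non-integrable function would have integral `0` by convention, not `1`. -/
theorem IsCSCAssociated.intervalIntegrable_comp_sub {b : ℝ} {k K : ℝ → ℝ}
    (hK : IsCSCAssociated b k K) {t : ℝ} (ht : 0 < t) (htb : t ≤ b) :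
    IntervalIntegrable (fun z => k (t - z) * K z) volume 0 t := by
  refine intervalIntegral.intervalIntegrable_of_integral_ne_zero ?_
  rw [hK.integral_comp_sub ht htb]
  exact one_ne_zero

/-- The convolution of `k` and `K`, weighted by `v` in the variable of `K`. -/
noncomputable def weightedConvolution (v k K : ℝ → ℝ) (t : ℝ) : ℝ :=
  ∫ z in (0 : ℝ)..t, v z * k (t - z) * K z

theorem intervalIntegrable_weighted {b : ℝ} {v k K : ℝ → ℝ} (hK : IsCSCAssociated b k K)
    (hv : Continuous v) {t : ℝ} (ht : 0 < t) (htb : t ≤ b) :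
    IntervalIntegrable (fun z => v z * k (t - z) * K z) volume 0 t := by
  simpa only [mul_assoc] using
    (hK.intervalIntegrable_comp_sub ht htb).continuousOn_mul hv.continuousOn

theorem weightedConvolution_sub {b : ℝ} {v k K : ℝ → ℝ} (hK : IsCSCAssociated b k K)
    (hv : Continuous v) (c : ℝ) {t : ℝ} (ht : 0 < t) (htb : t ≤ b) :
    weightedConvolution v k K t - c = ∫ z in (0 : ℝ)..t, (v z - c) * (k (t - z) * K z) := by
  have h := hK.intervalIntegrable_comp_sub ht htb
  have e : ∫ z in (0 : ℝ)..t, c * (k (t - z) * K z) = c := by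
    rw [intervalIntegral.integral_const_mul, hK.integral_comp_sub ht htb, mul_one]
  simp only [sub_mul]
  rw [intervalIntegral.integral_sub (h.continuousOn_mul hv.continuousOn) (h.const_mul c), e,
    weightedConvolution]
  simp only [mul_assoc]

namespace IsLICM

variable {k K : ℝ → ℝ} {b : ℝ}

/-- As `K ≥ 0`, `weightedConvolution v k K t` is the average of `v` over `(0,t)` for a probability
density. -/
theorem abs_weightedConvolution_sub_le (hk : IsLICM k) (hb : 0 < b)
    (hK : IsCSCAssociated b k K) {v : ℝ → ℝ} {Q : NNReal} (hv : LipschitzWith Q v) {t : ℝ}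
    (ht : 0 < t) (htb : t ≤ b) : |weightedConvolution v k K t - v 0| ≤ Q * t := by
  obtain ⟨C, hC⟩ := hk.partner_ae_mem hb hK
  rw [weightedConvolution_sub hK hv.continuous (v 0) ht htb]
  calc |∫ z in (0 : ℝ)..t, (v z - v 0) * (k (t - z) * K z)|
      ≤ ∫ z in (0 : ℝ)..t, Q * t * (k (t - z) * K z) := by
        rw [← Real.norm_eq_abs]
        refine intervalIntegral.norm_integral_le_of_norm_le ht.le ?_
          ((hK.intervalIntegrable_comp_sub ht htb).const_mul _)
        filter_upwards [hC, Measure.ae_ne volume t] with z hz hzt hzm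
        have hlt : z < t := lt_of_le_of_ne hzm.2 hzt
        have hnn : 0 ≤ k (t - z) * K z :=
          mul_nonneg (hk.isCompletelyMonotone.nonneg (sub_pos.2 hlt))
            (hz ⟨hzm.1, by linarith⟩).1
        rw [norm_mul, Real.norm_of_nonneg hnn]
        refine mul_le_mul_of_nonneg_right ?_ hnn
        rw [← dist_eq_norm]
        refine (hv.dist_le_mul z 0).trans (mul_le_mul_of_nonneg_left ?_ Q.2)
        rw [Real.dist_eq, sub_zero, abs_of_pos hzm.1]
        exact hzm.2
    _ = Q * t := by
        rw [intervalIntegral.integral_const_mul, hK.integral_comp_sub ht htb, mul_one]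

/-- An integrable bound for the derivative of `weightedConvolution v k K` per unit of the Lipschitz
constant of `v`. -/
noncomputable def derivMajorant (k K : ℝ → ℝ) (b t : ℝ) : ℝ :=
  ∫ x, (Iio b).indicator (fun x => (Ioi 0).indicator k (x / 2)) x * |(Ioo 0 b).indicator K (t - x)|

theorem integrable_derivMajorant (hk : IsLICM k) (hK : IsCSCAssociated b k K) :
    Integrable (derivMajorant k K b) := by
  have h1 : Integrable ((Iio b).indicator (fun x => (Ioi 0).indicator k (x / 2))) :=
    (integrable_indicator_iff measurableSet_Iio).2
      (hk.integrableOn_indicator_comp_div two_pos b)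
  have h2 : Integrable ((Ioo 0 b).indicator K) := hK.2.1.integrable_indicator measurableSet_Ioo
  exact h1.integrable_convolution (ContinuousLinearMap.mul ℝ ℝ) h2.abs

/-- With `t` frozen, subtracting the constant `v t` leaves the derivative in `τ` unchanged.
Substituting `x = t - z` turns the rest into `∫ φ(x) k(x + (τ - t)) dx`, where `φ` vanishes to first
order at the singularity `x = 0`. -/
theorem exists_hasDerivWithinAt_weightedConvolution (hk : IsLICM k) (hb : 0 < b)
    (hK : IsCSCAssociated b k K) {v : ℝ → ℝ} {Q : NNReal} (hv : LipschitzWith Q v) {t : ℝ}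
    (ht : 0 < t) (htb : t ≤ b) :
    ∃ d, HasDerivWithinAt (weightedConvolution v k K) d (Icc 0 b) t ∧
      |d| ≤ 2 * Q * derivMajorant k K b t := by
  obtain ⟨C, hC⟩ := hk.partner_ae_mem hb hK
  have hcm := hk.isCompletelyMonotone
  set K₀ := (Ioo 0 b).indicator K with hK₀
  have hK₀i : Integrable K₀ := hK.2.1.integrable_indicator measurableSet_Ioo
  set φ : ℝ → ℝ := fun x => (v (t - x) - v t) * K₀ (t - x)
  set m : ℝ → ℝ := fun x => Q * K₀ (t - x)
  have hm : Integrable m := (hK₀i.comp_sub_left t).const_mul _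
  have hφ : AEStronglyMeasurable φ volume := by
    have hc := hv.continuous
    exact (by fun_prop : Continuous fun x => v (t - x) - v t).aestronglyMeasurable.mul
      (hK₀i.comp_sub_left t).1
  have hφm : ∀ x, |φ x| ≤ |x| * |m x| := by
    intro x
    have h := hv.dist_le_mul (t - x) t
    rw [Real.dist_eq, Real.dist_eq, sub_sub_cancel_left, abs_neg] at h
    simp only [φ, m, abs_mul, NNReal.abs_eq]
    calc |v (t - x) - v t| * |K₀ (t - x)| ≤ (Q * |x|) * |K₀ (t - x)| :=
          mul_le_mul_of_nonneg_right h (abs_nonneg _)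
      _ = _ := by ring
  -- For `x < t/2` the argument `t - x` exceeds `t/2`, so the bound `K ≤ C/t` keeps `K` away from
  -- its own singularity at `0`.
  have hmC : ∀ᵐ x, x < t / 2 → |m x| ≤ Q * (|C| / (t / 2)) := by
    filter_upwards [(quasiMeasurePreserving_sub_left_of_right_invariant volume t).ae hC]
      with x hx hxt
    simp only [m, abs_mul, NNReal.abs_eq]
    refine mul_le_mul_of_nonneg_left ?_ Q.2
    by_cases hmem : t - x ∈ Ioo 0 b
    · rw [hK₀, indicator_of_mem hmem, abs_of_nonneg (hx hmem).1]
      refine (hx hmem).2.trans ?_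
      exact div_le_div₀ (abs_nonneg _) (le_abs_self _) (by positivity) (by linarith)
    · rw [hK₀, indicator_of_notMem hmem, abs_zero]
      positivity
  have hT : ∀ x, t < x → φ x = 0 := by
    intro x hx
    have : t - x ∉ Ioo 0 b := fun h => by linarith [h.1]
    simp only [φ, hK₀, indicator_of_notMem this, mul_zero]
  have hder := hk.hasDerivAt_integral_indicator (half_pos ht) hφ hm hmC hφm hT
  refine ⟨∫ x, φ x * (Ioi 0).indicator (deriv k) x, ?_, ?_⟩
  · have hd := (HasDerivAt.comp_sub_const t t (by rwa [sub_self])).add_const (v t)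
    refine (hd.hasDerivWithinAt (s := Icc 0 b)).congr_of_eventuallyEq_of_mem ?_ ⟨ht.le, htb⟩
    filter_upwards [self_mem_nhdsWithin, nhdsWithin_le_nhds (Ioi_mem_nhds ht)] with τ hτ hτ0
    have hτ0' : 0 < τ := hτ0
    rw [← sub_eq_iff_eq_add, weightedConvolution_sub hK hv.continuous (v t) hτ0' hτ.2,
      ← integral_sub_left_eq_self (fun x => φ x * (Ioi 0).indicator k (x + (τ - t))) volume t,
      intervalIntegral.integral_of_le hτ0'.le, ← integral_indicator measurableSet_Ioc]
    refine integral_congr_ae ?_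
    filter_upwards [Measure.ae_ne volume τ] with z hz
    simp only [φ, sub_sub_cancel]
    rw [show t - z + (τ - t) = τ - z by ring]
    by_cases hmem : z ∈ Ioc 0 τ
    · have hlt : z < τ := lt_of_le_of_ne hmem.2 hz
      rw [indicator_of_mem hmem, indicator_of_mem (show τ - z ∈ Ioi 0 from sub_pos.2 hlt), hK₀,
        indicator_of_mem (show z ∈ Ioo 0 b from ⟨hmem.1, hlt.trans_le hτ.2⟩)]
      ring
    · rw [indicator_of_notMem hmem]
      rcases le_or_gt z 0 with h | h
      · rw [hK₀, indicator_of_notMem (fun h' => not_lt.2 h h'.1)]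
        simp
      · rw [indicator_Ioi_zero_of_nonpos k (by by_contra! h'; exact hmem ⟨h, by linarith⟩)]
        simp
  · have hi := (hk.integrable_indicator_comp_div_mul hm.abs
      (C := Q * (|C| / (t / 2))) (by simpa using hmC) (half_pos ht) two_pos).const_mul 2
    have e : 2 * Q * derivMajorant k K b t = ∫ x, 2 * ((Ioi 0).indicator k (x / 2) * |m x|) := by
      rw [derivMajorant, ← integral_const_mul]
      refine integral_congr_ae (ae_of_all _ fun x => ?_)
      simp only [m, abs_mul, NNReal.abs_eq]
      rcases lt_or_ge x b with h | h
      · rw [indicator_of_mem (show x ∈ Iio b from h)]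
        ring
      -- The cutoff at `b` in `derivMajorant` costs nothing: `t - x ≤ 0` for `x ≥ b ≥ t`.
      · have hx : t - x ∉ Ioo 0 b := fun h' => by linarith [h'.1]
        rw [hK₀, indicator_of_notMem hx]
        simp
    rw [e, ← Real.norm_eq_abs]
    refine norm_integral_le_of_norm_le hi (ae_of_all _ fun x => ?_)
    rw [norm_mul, Real.norm_eq_abs, Real.norm_eq_abs]
    rcases le_or_gt x 0 with h | h
    · rw [indicator_Ioi_zero_of_nonpos _ h, indicator_Ioi_zero_of_nonpos _ (by linarith)]
      simp
    · rw [indicator_of_mem (show x ∈ Ioi 0 from h),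
        indicator_of_mem (show x / 2 ∈ Ioi 0 from half_pos h)]
      calc |φ x| * |deriv k x| ≤ |x| * |m x| * |deriv k x| :=
            mul_le_mul_of_nonneg_right (hφm x) (abs_nonneg _)
        _ = |m x| * (x * |deriv k x|) := by rw [abs_of_pos h]; ring
        _ ≤ |m x| * (2 * k (x / 2)) :=
            mul_le_mul_of_nonneg_left (hcm.mul_abs_deriv_le h) (abs_nonneg _)
        _ = _ := by ring

end IsLICM

/-! ### From Lipschitz weights to the weighted Sonine condition -/

/-- The results above need a weight that is Lipschitz on all of `ℝ`. The mean value inequality and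
an extension supply one for each `s`, with a constant independent of `s`. -/
theorem WeightDerivBounded.exists_lipschitz_extension {b : ℝ} {w : ℝ → ℝ → ℝ} {Q s : ℝ}
    (hw : WeightDerivBounded b w Q) (hs : 0 ≤ s) :
    ∃ v : ℝ → ℝ, LipschitzWith Q.toNNReal v ∧ ∀ z ∈ Icc 0 (b - s), v z = w s (z + s) := by
  have h : LipschitzOnWith Q.toNNReal (w s) (Icc s b) := by
    refine (convex_Icc s b).lipschitzOnWith_of_nnnorm_derivWithin_le (𝕜 := ℝ)
      (fun t ht => (hw s t hs ht.1 ht.2).1) fun t ht => ?_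
    rw [← NNReal.coe_le_coe, coe_nnnorm, Real.norm_eq_abs]
    exact (hw s t hs ht.1 ht.2).2.trans (Real.le_coe_toNNReal Q)
  have h' : LipschitzOnWith Q.toNNReal (fun z => w s (z + s)) (Icc 0 (b - s)) := by
    refine LipschitzOnWith.of_dist_le_mul fun x hx y hy => ?_
    have := h.dist_le_mul (x + s) ⟨by linarith [hx.1], by linarith [hx.2]⟩ (y + s)
      ⟨by linarith [hy.1], by linarith [hy.2]⟩
    rwa [dist_add_right] at this
  obtain ⟨v, hv, heq⟩ := h'.extend_real
  exact ⟨v, hv, fun z hz => (heq hz).symm⟩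

theorem IsCSCAssociated.isWSC2Associated {b : ℝ} (hb : 0 < b) {k K : ℝ → ℝ} (hk : IsLICM k)
    {w : ℝ → ℝ → ℝ} (hw : WeightNondegenerate b w) {Q : ℝ} (hQ : WeightDerivBounded b w Q)
    (hK : IsCSCAssociated b k K) : IsWSC2Associated b w k K := by
  -- At `t = 0` the integral is empty and would give `0`; the limit `w s s` is put in by hand.
  set G : ℝ → ℝ → ℝ := fun s t =>
    if t ≤ 0 then w s s else ∫ z in (0 : ℝ)..t, w s (z + s) * k (t - z) * K z
  have hG0 : ∀ s, G s 0 = w s s := fun s => if_pos le_rfl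
  have hGt : ∀ s t, 0 < t → G s t = ∫ z in (0 : ℝ)..t, w s (z + s) * k (t - z) * K z :=
    fun s t ht => if_neg (not_le.2 ht)
  have hcongr : ∀ s (v : ℝ → ℝ), (∀ z ∈ Icc 0 (b - s), v z = w s (z + s)) →
      ∀ t, 0 < t → s + t ≤ b → G s t = weightedConvolution v k K t := by
    intro s v hv t ht hst
    rw [hGt s t ht, weightedConvolution]
    refine intervalIntegral.integral_congr fun z hz => ?_
    rw [uIcc_of_le ht.le] at hz
    rw [hv z ⟨hz.1, by linarith [hz.2]⟩]
  have hderiv : ∀ s t, 0 ≤ s → 0 < t → s + t ≤ b → ∃ d,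
      HasDerivWithinAt (G s) d (Icc 0 (b - s)) t ∧
        |d| ≤ 2 * Q.toNNReal * IsLICM.derivMajorant k K b t := by
    intro s t hs ht hst
    obtain ⟨v, hv, hvw⟩ := hQ.exists_lipschitz_extension hs
    obtain ⟨d, hd, hdb⟩ := hk.exists_hasDerivWithinAt_weightedConvolution hb hK hv ht
      (by linarith)
    refine ⟨d, (hd.mono (Icc_subset_Icc_right (by linarith))).congr_of_eventuallyEq_of_mem ?_
      ⟨ht.le, by linarith⟩, hdb⟩
    filter_upwards [self_mem_nhdsWithin, nhdsWithin_le_nhds (Ioi_mem_nhds ht)] with τ hτ hτ0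
    exact hcongr s v hvw τ hτ0 (by linarith [hτ.2])
  refine ⟨hK.1, hK.2.1, G, fun s t hs ht hst => ⟨?_, (hGt s t ht).symm⟩, ?_, ?_, ?_⟩
  · obtain ⟨v, hv, hvw⟩ := hQ.exists_lipschitz_extension hs
    refine (intervalIntegrable_weighted hK hv.continuous ht (by linarith)).congr ?_
    intro z hz
    rw [uIoc_of_le ht.le] at hz
    beta_reduce
    rw [hvw z ⟨hz.1.le, by linarith [hz.2]⟩]
  · obtain ⟨μ₁, μ₂, h1, h2, h3⟩ := hw
    exact ⟨μ₁, μ₂, h1, h2, fun s hs hsb => by rw [hG0]; exact h3 s hs hsb⟩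
  · intro s hs hsb t ht
    -- Continuity at `0` comes from the averaging estimate, elsewhere from differentiability.
    rcases ht.1.eq_or_lt with rfl | h0
    · obtain ⟨v, hv, hvw⟩ := hQ.exists_lipschitz_extension hs
      have hlim : Filter.Tendsto (fun t : ℝ => (Q.toNNReal : ℝ) * t)
          (nhdsWithin 0 (Icc 0 (b - s))) (nhds 0) := by
        have hc : Continuous fun t : ℝ => (Q.toNNReal : ℝ) * t := by fun_prop
        simpa using (hc.tendsto 0).mono_left (nhdsWithin_le_nhds (s := Icc 0 (b - s)))
      rw [ContinuousWithinAt, tendsto_iff_dist_tendsto_zero]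
      refine squeeze_zero' (Filter.Eventually.of_forall fun _ => dist_nonneg) ?_ hlim
      filter_upwards [self_mem_nhdsWithin] with t ht
      rcases ht.1.eq_or_lt with rfl | h0
      · simp
      · have h := hk.abs_weightedConvolution_sub_le hb hK hv h0 (by linarith [ht.2])
        rw [hvw 0 ⟨le_rfl, by linarith⟩, zero_add] at h
        rw [hG0, hcongr s v hvw t h0 (by linarith [ht.2]), Real.dist_eq]
        exact h
    · obtain ⟨d, hd, -⟩ := hderiv s t hs h0 (by linarith [ht.2])
      exact hd.continuousWithinAt
  · refine ⟨fun t => 2 * Q.toNNReal * IsLICM.derivMajorant k K b t,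
      ((hk.integrable_derivMajorant hK).const_mul _).integrableOn, fun s t hs ht hst => ?_⟩
    obtain ⟨d, hd, hdb⟩ := hderiv s t hs ht hst
    refine ⟨hd.differentiableWithinAt, ?_⟩
    rwa [hd.derivWithin (uniqueDiffOn_Icc (by linarith) t ⟨ht.le, by linarith⟩)]

theorem theorem4p3 (b : ℝ) (hb : 0 < b) (k : ℝ → ℝ) (hk : IsLICM k) (hS : SatisfiesCSC b k)
    (w : ℝ → ℝ → ℝ) (hw : WeightNondegenerate b w) (hw2 : ∃ Q : ℝ, WeightDerivBounded b w Q) :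
    SatisfiesWSC2 b w k ∧
      ∀ K : ℝ → ℝ, IsCSCAssociated b k K → IsWSC2Associated b w k K := by
  obtain ⟨Q, hQ⟩ := hw2
  have h : ∀ K : ℝ → ℝ, IsCSCAssociated b k K → IsWSC2Associated b w k K := fun _ hK =>
    hK.isWSC2Associated hb hk hw hQ
  obtain ⟨K, hK⟩ := hS
  exact ⟨⟨K, h K hK⟩, h⟩
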